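/- All graphs are finite. An \emph{arborescence} is an oriented tree with a root from which there is a directed path in the tree to every vertex of the tree; its \emph{depth} is the length (number of edges) of a longest directed path in it. An edge-coloured arborescence is \emph{path-monochromatic} if each of its directed paths is monochromatic. For positive integers $k,\ell$ and a tournament $T$, let $f_T(k,\ell)$ be the largest integer $m$ such that for every colouring of the edges of $T$ with $k$ colours, $T$ has a path-monochromatic subtree (a subgraph that is an arborescence) of depth at most $\ell$ with at least $m$ vertices, and let $f_T(k)$ be defined in the same way without restriction on the depth. Let $f(k,\ell,n)$ and $f(k,n)$ be the minimum of $f_T(k,\ell)$ and of $f_T(k)$, respectively, over all tournaments $T$ with $n$ vertices, and let $f(k,\ell)=\lim_{n\to\infty} f(k,\ell,n)/n$ and $f(k)=\lim_{n\to\infty} f(k,n)/n$ when these limits exist. The Caccetta--Häggkvist conjecture (CH) states that for all integers $n,r\ge 1$, every loopless digraph without parallel edges with $n$ vertices and minimum out-degree at least $r$ has a directed cycle of length at most $\lceil n/r\rceil$. \textbf{Theorem.} (i) The limit $f(2,2)$ exists and $\sqrt7-2\le f(2,2)\le \frac23$ (unconditionally). (ii) If CH holds, then for every $\ell\ge 2$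 the limit $f(2,\ell)$ exists and equals $\frac{\ell}{\ell+1}$. (iii) For every $k\ge 3$ the limit $f(k)$ exists and equals $\frac12$; moreover, for every $k\ge 3$ and every $\ell\ge 2$ the limit $f(k,\ell)$ exists and equals $\frac12$. -/

import Mathlib

open Filter Topology

namespace PathMono

/-- A directed path of the digraph `D`: the nonempty list of its (distinct) vertices, each of them
joined by an edge to the next one. Its length, as a path, is the length of the list minus one. -/
def IsDirPath {V : Type*} (D : Digraph V) (p : List V) : Prop :=
  p ≠ [] ∧ p.Nodup ∧ p.IsChain D.Adj

/-- `D` has a directed cycle of length `m` (with `m` distinct vertices, indexed cyclically). -/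
def HasDirCycle {V : Type*} (D : Digraph V) (m : ℕ) : Prop :=
  0 < m ∧ ∃ x : ZMod m → V, Function.Injective x ∧ ∀ i, D.Adj (x i) (x (i + 1))

/-- The Caccetta-Häggkvist Conjecture: if a (loopless, finite, nonempty) digraph with `n` vertices
has minimum out-degree at least `r ≥ 1`, then it has a directed cycle of length at most
`⌈n / r⌉`. -/
def CaccettaHaggkvist : Prop :=
  ∀ n r : ℕ, 0 < n → 0 < r → ∀ D : Digraph (Fin n), (∀ v, ¬ D.Adj v v) →
    (∀ v, r ≤ {w | D.Adj v w}.ncard) →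
      ∃ m : ℕ, m ≤ ⌈(n : ℚ) / (r : ℚ)⌉₊ ∧ HasDirCycle D m

/-- A tournament: no loops, and exactly one of the two possible edges between any two distinct
vertices. -/
structure IsTournament {V : Type*} (T : Digraph V) : Prop where
  loopless : ∀ v, ¬ T.Adj v v
  adj_xor : ∀ u v, u ≠ v → Xor (T.Adj u v) (T.Adj v u)

/-- The digraph with vertex set `S` and edge relation `A` is an arborescence with root `r`: an
oriented tree such that every vertex is the end of a directed path, in the tree, from the root. -/
structure IsArborescence {V : Type*} (S : Finset V) (A : Digraph V) (r : V) : Prop where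
  mem_of_adj : ∀ u v, A.Adj u v → u ∈ S ∧ v ∈ S
  oriented : ∀ u v, A.Adj u v → ¬ A.Adj v u
  isTree : (A.toSimpleGraphInclusive.induce (S : Set V)).IsTree
  root_mem : r ∈ S
  reach : ∀ v ∈ S, ∃ p : List V, IsDirPath A p ∧ p.head? = some r ∧ p.getLast? = some v

/-- Every directed path of `A` is monochromatic; `c u v` is the colour of the edge `(u, v)`. -/
def IsPathMonochromatic {V : Type*} {k : ℕ} (c : V → V → Fin k) (A : Digraph V) : Prop :=
  ∀ p : List V, IsDirPath A p → ∃ a : Fin k, p.IsChain (fun u v => c u v = a)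

/-- Every directed path of `A` has length at most `ℓ`. -/
def DepthAtMost {V : Type*} (A : Digraph V) (ℓ : ℕ) : Prop :=
  ∀ p : List V, IsDirPath A p → p.length - 1 ≤ ℓ

/-- `f_T(k, ℓ)`: the largest `m` such that for every colouring of the edges of `T` with `k` colours,
`T` has a path-monochromatic arborescence of depth at most `ℓ` with at least `m` vertices. A colouring
is given as a function on all ordered pairs, whose values on pairs that are not edges of `T` are
never used. -/
noncomputable def fDepthOf {V : Type*} (T : Digraph V) (k ℓ : ℕ) : ℕ :=
  sSup {m : ℕ | ∀ c : V → V → Fin k, ∃ (S : Finset V) (A : Digraph V) (r : V),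
    A ≤ T ∧ IsArborescence S A r ∧ IsPathMonochromatic c A ∧ DepthAtMost A ℓ ∧ m ≤ S.card}

/-- `f_T(k)`: the same without a restriction of the depth. -/
noncomputable def fOf {V : Type*} (T : Digraph V) (k : ℕ) : ℕ :=
  sSup {m : ℕ | ∀ c : V → V → Fin k, ∃ (S : Finset V) (A : Digraph V) (r : V),
    A ≤ T ∧ IsArborescence S A r ∧ IsPathMonochromatic c A ∧ m ≤ S.card}

/-- `f(k, ℓ, n)`: the minimum of `f_T(k, ℓ)` over all tournaments `T` with `n` vertices. -/
noncomputable def fDepth (k ℓ n : ℕ) : ℕ :=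
  sInf {m : ℕ | ∃ T : Digraph (Fin n), IsTournament T ∧ m = fDepthOf T k ℓ}

/-- `f(k, n)`: the minimum of `f_T(k)` over all tournaments `T` with `n` vertices. -/
noncomputable def fMin (k n : ℕ) : ℕ :=
  sInf {m : ℕ | ∃ T : Digraph (Fin n), IsTournament T ∧ m = fOf T k}

/-- `f(k, ℓ) = lim f(k, ℓ, n) / n` exists and equals `x`. -/
def FDepthLimit (k ℓ : ℕ) (x : ℝ) : Prop :=
  Tendsto (fun n : ℕ => (fDepth k ℓ n : ℝ) / (n : ℝ)) atTop (𝓝 x)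

/-- `f(k) = lim f(k, n) / n` exists and equals `x`. -/
def FLimit (k : ℕ) (x : ℝ) : Prop :=
  Tendsto (fun n : ℕ => (fMin k n : ℝ) / (n : ℝ)) atTop (𝓝 x)

end PathMono

/-!
The argument replaces trees by reach numbers. A path-monochromatic tree with root `r` and depth at
most `L` lies in the set `monoReach T c L r` of the vertices that are reached from `r` by
monochromatic walks with at most `L` edges. Upper bounds for the extremal numbers therefore follow
from colourings in which all these sets are small (`ReachBound`). Such colourings can be blown up
(`ReachBound.blowUp`) and padded (`ReachBound.succ`), so one good colouring of a small tournament
bounds the upper density for all numbers of vertices (`tendsto_of_reachBound`). The colourings used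
are iterated cyclic triangles with three colours (`reachBound_three_pow`, density `1 / 2`) and a
cyclic arrangement with two colours (`reachBound_cyclic`, density `ℓ / (ℓ + 1)`).

Lower bounds need trees. With three or more colours a star with half of the vertices suffices. For
depth two, a tree can contain all of `monoReach T c 2 r` (`exists_monoTree_two`); hence `f(2, 2)`
is the infimum of the densities, and the limit exists. In a 2-coloured tournament, the digraph that
joins each vertex to those it does not reach in two steps has no directed cycle of length two or
three, so Shen's theorem (`exists_outdegree_lt`), which is proved here by induction and by counting
transitive triangles, gives a vertex that reaches a proportion of at least `√7 - 2`.

For depth `ℓ` and two colours, the digraph of the pairs that are not joined by monochromatic walks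
with at most `ℓ` edges has no directed cycle with at most `ℓ + 1` vertices, because some vertex of
the cycle reaches all others inside the cycle (Sands, Sauer and Woodrow,
`exists_dominating_of_two_colours`). The Caccetta-Häggkvist conjecture then gives a vertex that
reaches a proportion of about `ℓ / (ℓ + 1)`. For `ℓ ≥ 3` this is not yet a tree: a red and a blue
walk from the root may need the same vertex in their interiors. The remedy is to count only robust
walks (`RobustWalk`), for which there are linearly many candidates for each interior vertex. A walk
that is not robust passes through a defect (`IsDefect`), defects have a small density, and a random
sample of bounded size avoids all of them while it inherits the minimum out-degree
(`exists_sample`). So the previous argument, applied to a sample, gives a vertex that robustly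
reaches a proportion of at least `ℓ / (ℓ + 1) - ε` (`CaccettaHaggkvist.exists_robust`). Finally, a
greedy choice of boundedly many disjoint robust paths from this vertex, to which almost all
vertices that are robustly reached can be attached as leaves, produces a tree
(`MonoTree.exists_of_robust`).
-/

namespace PathMono

/-! ### Monochromatic walks and monochromatic trees -/

/-- There is a walk in `T` from `v` to `u` with at most `j` edges, all of them of colour `a`. -/
def MonoWalk {V : Type*} {k : ℕ} (T : Digraph V) (c : V → V → Fin k) (a : Fin k) :
    ℕ → V → V → Prop
  | 0, v, u => u = v
  | j + 1, v, u => MonoWalk T c a j v u ∨ ∃ w, MonoWalk T c a j v w ∧ T.Adj w u ∧ c w u = a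

/-- The vertices that can be reached from `v` by a monochromatic walk with at most `L` edges;
`L = ⊤` means that the length is not restricted. -/
def monoReach {V : Type*} {k : ℕ} (T : Digraph V) (c : V → V → Fin k) (L : ℕ∞) (v : V) : Set V :=
  {u | ∃ a, ∃ j : ℕ, (j : ℕ∞) ≤ L ∧ MonoWalk T c a j v u}

section MonoWalk

variable {V : Type*} {k : ℕ} {T : Digraph V} {c : V → V → Fin k} {a : Fin k}

lemma MonoWalk.refl (j : ℕ) (v : V) : MonoWalk T c a j v v := by
  induction j with
  | zero => rfl
  | succ j ih => exact Or.inl ih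

lemma MonoWalk.mono {i j : ℕ} (hij : i ≤ j) {v u : V} (h : MonoWalk T c a i v u) :
    MonoWalk T c a j v u := by
  induction j, hij using Nat.le_induction with
  | base => exact h
  | succ j _ ih => exact Or.inl ih

lemma MonoWalk.of_isChain {v : V} (p : List V) : ∀ (i : ℕ) (x u : V), MonoWalk T c a i v x →
    (x :: p).IsChain T.Adj → (x :: p).IsChain (fun y z => c y z = a) →
    (x :: p).getLast? = some u → MonoWalk T c a (i + p.length) v u := by
  induction p with
  | nil =>
    intro i x u hx _ _ hu
    simp at hu
    subst hu
    simpa using hx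
  | cons y p ih =>
    intro i x u hx hT hc hu
    rw [List.isChain_cons_cons] at hT hc
    have := ih (i + 1) y u (Or.inr ⟨x, hx, hT.1, hc.1⟩) hT.2 hc.2 (by simpa using hu)
    simpa [add_assoc, add_comm 1] using this

/-- The vertices of a path-monochromatic arborescence are reached from its root by monochromatic
walks. -/
lemma IsArborescence.subset_monoReach {S : Finset V} {A : Digraph V} {r : V} {L : ℕ∞}
    (hA : IsArborescence S A r) (hT : A ≤ T) (hm : IsPathMonochromatic c A)
    (hL : ∀ p : List V, IsDirPath A p → ((p.length - 1 : ℕ) : ℕ∞) ≤ L) :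
    (S : Set V) ⊆ monoReach T c L r := by
  intro v hv
  obtain ⟨p, hp, hr, hlast⟩ := hA.reach v hv
  obtain ⟨a, ha⟩ := hm p hp
  have hlen := hL p hp
  obtain _ | ⟨x, p⟩ := p
  · exact absurd rfl hp.1
  · obtain rfl : x = r := by simpa using hr
    refine ⟨a, p.length, by simpa using hlen, ?_⟩
    have := MonoWalk.of_isChain (T := T) (c := c) (a := a) (v := x) p 0 x v rfl
      (hp.2.2.imp fun _ _ h => hT h) ha hlast
    simpa using this

end MonoWalk

/-- A path-monochromatic tree in `T` with root `r`, given by the parent and the depth of every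
vertex. The values of `par` and `dep` outside `verts`, and the parent of the root, do not
matter. -/
structure MonoTree {V : Type*} {k : ℕ} (T : Digraph V) (c : V → V → Fin k) (r : V) where
  verts : Finset V
  par : V → V
  dep : V → ℕ
  root_mem : r ∈ verts
  dep_root : dep r = 0
  par_mem : ∀ v ∈ verts, v ≠ r → par v ∈ verts
  adj : ∀ v ∈ verts, v ≠ r → T.Adj (par v) v
  dep_par : ∀ v ∈ verts, v ≠ r → dep v = dep (par v) + 1
  mono : ∀ v ∈ verts, v ≠ r → par v ≠ r → c (par (par v)) (par v) = c (par v) v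

namespace MonoTree

variable {V : Type*} {k : ℕ} {T : Digraph V} {c : V → V → Fin k} {r : V}

/-- The edges from parents to children. -/
def toDigraph (t : MonoTree T c r) : Digraph V where
  Adj u v := v ∈ t.verts ∧ v ≠ r ∧ u = t.par v

lemma toDigraph_le (t : MonoTree T c r) : t.toDigraph ≤ T := by
  rintro u v ⟨hv, hne, rfl⟩
  exact t.adj v hv hne

lemma dep_of_adj (t : MonoTree T c r) {u v : V} (h : t.toDigraph.Adj u v) :
    t.dep v = t.dep u + 1 := by
  obtain ⟨hv, hne, rfl⟩ := h
  exact t.dep_par v hv hne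

lemma exists_path (t : MonoTree T c r) (d : ℕ) : ∀ v ∈ t.verts, t.dep v = d →
    ∃ p : List V, IsDirPath t.toDigraph p ∧ p.head? = some r ∧ p.getLast? = some v ∧
      ∀ x ∈ p, t.dep x ≤ d := by
  induction d with
  | zero =>
    intro v hv hd
    have hvr : v = r := by
      by_contra hne
      have := t.dep_par v hv hne
      omega
    subst hvr
    exact ⟨[v], ⟨by simp, by simp, by simp⟩, by simp, by simp, by simp [hd]⟩
  | succ d ih =>
    intro v hv hd
    have hne : v ≠ r := by
      rintro rfl
      have := t.dep_root
      omega
    have hdp := t.dep_par v hv hne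
    obtain ⟨p, ⟨hp0, hp1, hp2⟩, hhead, hlast, hdep⟩ :=
      ih (t.par v) (t.par_mem v hv hne) (by omega)
    refine ⟨p ++ [v], ⟨by simp, ?_, ?_⟩, ?_, by simp, ?_⟩
    · rw [List.nodup_append]
      refine ⟨hp1, by simp, ?_⟩
      intro x hx y hy
      simp at hy
      subst hy
      rintro rfl
      have := hdep x hx
      omega
    · rw [List.isChain_append]
      refine ⟨hp2, by simp, ?_⟩
      intro x hx y hy
      rw [hlast] at hx
      simp at hx hy
      subst hx hy
      exact ⟨hv, hne, rfl⟩
    · rw [List.head?_append, hhead]; rfl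
    · intro x hx
      rw [List.mem_append] at hx
      rcases hx with hx | hx
      · exact (hdep x hx).trans (Nat.le_succ d)
      · simp at hx; rw [hx, hd]

lemma isPathMonochromatic (t : MonoTree T c r) : IsPathMonochromatic c t.toDigraph := by
  rintro p ⟨hp, -, hch⟩
  -- every edge of a path that starts at `x` has the colour of the first one
  have key : ∀ (p : List V) (x y : V), (x :: y :: p).IsChain t.toDigraph.Adj →
      (x :: y :: p).IsChain (fun u v => c u v = c x y) := by
    intro p
    induction p with
    | nil => intro x y _; simp
    | cons z p ih =>
      intro x y h
      rw [List.isChain_cons_cons] at h ⊢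
      refine ⟨rfl, ?_⟩
      have h2 := ih y z h.2
      obtain ⟨⟨hy, hyr, rfl⟩, h3⟩ := h
      rw [List.isChain_cons_cons] at h3
      obtain ⟨⟨hz, hzr, rfl⟩, -⟩ := h3
      rw [t.mono z hz hzr hyr]
      exact h2
  match p, hch with
  | [], _ => exact absurd rfl hp
  | [x], _ => exact ⟨c x x, by simp⟩
  | x :: y :: p, hch => exact ⟨c x y, key p x y hch⟩

lemma length_le_of_isChain (t : MonoTree T c r) {L : ℕ} (hL : ∀ v ∈ t.verts, t.dep v ≤ L) :
    ∀ (p : List V) (x : V), x ∈ t.verts → (x :: p).IsChain t.toDigraph.Adj →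
      t.dep x + p.length ≤ L := by
  intro p
  induction p with
  | nil => intro x hx _; simpa using hL x hx
  | cons y p ih =>
    intro x _ h
    rw [List.isChain_cons_cons] at h
    have := ih y h.1.1 h.2
    have := t.dep_of_adj h.1
    simp only [List.length_cons]
    omega

lemma depthAtMost (t : MonoTree T c r) {L : ℕ} (hL : ∀ v ∈ t.verts, t.dep v ≤ L) :
    DepthAtMost t.toDigraph L := by
  rintro p ⟨hp, -, hch⟩
  match p, hch with
  | [], _ => exact absurd rfl hp
  | [x], _ => simp
  | x :: y :: p, hch =>
    rw [List.isChain_cons_cons] at hch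
    have h1 := t.length_le_of_isChain hL p y hch.1.1 hch.2
    have h2 := t.dep_of_adj hch.1
    simp only [List.length_cons]
    omega

lemma isTree_induce (t : MonoTree T c r) :
    (t.toDigraph.toSimpleGraphInclusive.induce (t.verts : Set V)).IsTree := by
  classical
  set G := t.toDigraph.toSimpleGraphInclusive.induce (t.verts : Set V) with hG
  have hadj : ∀ x (hx : x ∈ t.verts) (hne : x ≠ r),
      G.Adj ⟨t.par x, t.par_mem x hx hne⟩ ⟨x, hx⟩ := by
    intro x hx hne
    rw [hG, SimpleGraph.induce_adj]
    refine ⟨?_, Or.inl ⟨hx, hne, rfl⟩⟩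
    intro h
    have h1 := t.dep_par x hx hne
    change t.par x = x at h
    rw [h] at h1
    omega
  have hreach : ∀ d x (hx : x ∈ t.verts), t.dep x = d → G.Reachable ⟨r, t.root_mem⟩ ⟨x, hx⟩ := by
    intro d
    induction d with
    | zero =>
      intro x hx hd
      by_cases hne : x = r
      · subst hne; exact SimpleGraph.Reachable.refl _
      · have := t.dep_par x hx hne
        omega
    | succ d ih =>
      intro x hx hd
      by_cases hne : x = r
      · subst hne; exact SimpleGraph.Reachable.refl _
      · exact (ih _ (t.par_mem x hx hne) (by have := t.dep_par x hx hne; omega)).trans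
          (hadj x hx hne).reachable
  have hconn : G.Connected := by
    have : Nonempty (t.verts : Set V) := ⟨⟨r, t.root_mem⟩⟩
    refine ⟨fun x y => ?_⟩
    exact (hreach _ x.1 x.2 rfl).symm.trans (hreach _ y.1 y.2 rfl)
  rw [SimpleGraph.isTree_iff_connected_and_card]
  refine ⟨hconn, le_antisymm ?_ hconn.card_vert_le_card_edgeSet_add_one⟩
  -- every edge is the edge above a vertex other than the root
  let f : {x : (t.verts : Set V) // x ≠ ⟨r, t.root_mem⟩} → G.edgeSet := fun x =>
    ⟨s(⟨t.par x.1.1, t.par_mem x.1.1 x.1.2 (fun h => x.2 (Subtype.ext h))⟩, x.1),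
      hadj x.1.1 x.1.2 (fun h => x.2 (Subtype.ext h))⟩
  have hf : Function.Surjective f := by
    rintro ⟨e, he⟩
    induction e using Sym2.ind with
    | _ u v =>
      have he' : G.Adj u v := he
      obtain ⟨-, h⟩ := SimpleGraph.induce_adj.1 he'
      rcases h with ⟨-, hr, hp⟩ | ⟨-, hr, hp⟩
      · refine ⟨⟨v, fun h => hr (congrArg Subtype.val h)⟩, Subtype.ext ?_⟩
        exact Sym2.eq_iff.2 (Or.inl ⟨Subtype.ext hp.symm, rfl⟩)
      · refine ⟨⟨u, fun h => hr (congrArg Subtype.val h)⟩, Subtype.ext ?_⟩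
        exact Sym2.eq_iff.2 (Or.inr ⟨Subtype.ext hp.symm, rfl⟩)
  have h1 := Nat.card_le_card_of_surjective f hf
  have h2 : Nat.card {x : (t.verts : Set V) // x ≠ ⟨r, t.root_mem⟩} + 1 =
      Nat.card (t.verts : Set V) := by
    rw [Nat.card_eq_fintype_card, Nat.card_eq_fintype_card, Fintype.card_subtype_compl,
      Fintype.card_subtype_eq]
    have : 0 < Fintype.card (t.verts : Set V) :=
      Fintype.card_pos_iff.2 ⟨⟨r, t.root_mem⟩⟩
    omega
  omega

lemma isArborescence (t : MonoTree T c r) : IsArborescence t.verts t.toDigraph r where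
  mem_of_adj := by
    rintro u v ⟨hv, hne, rfl⟩
    exact ⟨t.par_mem v hv hne, hv⟩
  oriented u v h1 h2 := by
    have := t.dep_of_adj h1
    have := t.dep_of_adj h2
    omega
  isTree := t.isTree_induce
  root_mem := t.root_mem
  reach v hv := by
    obtain ⟨p, h1, h2, h3, -⟩ := t.exists_path _ v hv rfl
    exact ⟨p, h1, h2, h3⟩

/-- The tree that consists of its root. -/
def single (T : Digraph V) (c : V → V → Fin k) (r : V) : MonoTree T c r where
  verts := {r}
  par := id
  dep := fun _ => 0
  root_mem := by simp
  dep_root := rfl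
  par_mem := by simp
  adj := by simp
  dep_par := by simp
  mono := by simp

/-- A new leaf `u` can be attached to any vertex `w` of the tree to which it is joined in the right
colour. -/
lemma exists_addLeaf (t : MonoTree T c r) {u w : V} (hu : u ∉ t.verts) (hw : w ∈ t.verts)
    (hadj : T.Adj w u) (hcol : w ≠ r → c (t.par w) w = c w u) :
    ∃ t' : MonoTree T c r, (t'.verts : Set V) = insert u (t.verts : Set V) ∧
      (∀ x ∈ t.verts, t'.dep x = t.dep x ∧ t'.par x = t.par x) ∧
      t'.dep u = t.dep w + 1 ∧ t'.par u = w := by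
  classical
  have hne : ∀ x ∈ t.verts, x ≠ u := fun x hx h => hu (h ▸ hx)
  have hru : r ≠ u := hne r t.root_mem
  refine ⟨⟨insert u t.verts, Function.update t.par u w, Function.update t.dep u (t.dep w + 1),
    Finset.mem_insert_of_mem t.root_mem, ?_, ?_, ?_, ?_, ?_⟩, by simp, ?_, by simp, by simp⟩
  · rw [Function.update_of_ne hru, t.dep_root]
  · intro v hv hvr
    rcases Finset.mem_insert.1 hv with rfl | hv
    · simp [hw]
    · rw [Function.update_of_ne (hne v hv)]
      exact Finset.mem_insert_of_mem (t.par_mem v hv hvr)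
  · intro v hv hvr
    rcases Finset.mem_insert.1 hv with rfl | hv
    · simpa using hadj
    · rw [Function.update_of_ne (hne v hv)]
      exact t.adj v hv hvr
  · intro v hv hvr
    rcases Finset.mem_insert.1 hv with rfl | hv
    · simp [hne w hw]
    · rw [Function.update_of_ne (hne v hv), Function.update_of_ne (hne v hv),
        Function.update_of_ne (hne _ (t.par_mem v hv hvr))]
      exact t.dep_par v hv hvr
  · intro v hv hvr
    rcases Finset.mem_insert.1 hv with rfl | hv
    · simp only [Function.update_self, Function.update_of_ne (hne w hw)]
      exact hcol
    · rw [Function.update_of_ne (hne v hv),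
        Function.update_of_ne (hne _ (t.par_mem v hv hvr))]
      exact t.mono v hv hvr
  · intro x hx
    simp [Function.update_of_ne (hne x hx)]

/-- Any number of new leaves can be attached simultaneously to the vertices of a tree. -/
lemma exists_addLeaves (t : MonoTree T c r) {L : ℕ} (hL : ∀ v ∈ t.verts, t.dep v ≤ L)
    (X : Finset V) (hX : ∀ u ∈ X, u ∈ t.verts ∨ ∃ w ∈ t.verts, T.Adj w u ∧ t.dep w < L ∧
      (w ≠ r → c (t.par w) w = c w u)) :
    ∃ t' : MonoTree T c r, t.verts ⊆ t'.verts ∧ X ⊆ t'.verts ∧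
      (∀ x ∈ t.verts, t'.dep x = t.dep x ∧ t'.par x = t.par x) ∧ ∀ v ∈ t'.verts, t'.dep v ≤ L := by
  classical
  induction X using Finset.induction_on with
  | empty => exact ⟨t, subset_rfl, by simp, by simp, hL⟩
  | insert u X _ ih =>
    obtain ⟨t', h1, h2, h3, h4⟩ := ih fun u hu => hX u (Finset.mem_insert_of_mem hu)
    by_cases hu : u ∈ t'.verts
    · exact ⟨t', h1, Finset.insert_subset hu h2, h3, h4⟩
    · rcases hX u (Finset.mem_insert_self _ _) with h | ⟨w, hw, hadj, hd, hcol⟩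
      · exact absurd (h1 h) hu
      · obtain ⟨s, hs1, hs2, hs3, -⟩ := t'.exists_addLeaf hu (h1 hw) hadj
          (by rw [(h3 w hw).2]; exact hcol)
        have hsub : t'.verts ⊆ s.verts := by
          intro x hx
          have : x ∈ (s.verts : Set V) := by rw [hs1]; exact Or.inr hx
          exact this
        have hus : u ∈ s.verts := by
          have : u ∈ (s.verts : Set V) := by rw [hs1]; exact Or.inl rfl
          exact this
        refine ⟨s, h1.trans hsub, Finset.insert_subset hus (h2.trans hsub), ?_, ?_⟩
        · intro x hx
          rw [(hs2 x (h1 hx)).1, (hs2 x (h1 hx)).2]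
          exact h3 x hx
        · intro v hv
          have hv' : v ∈ (s.verts : Set V) := hv
          rw [hs1] at hv'
          rcases hv' with rfl | hv'
          · rw [hs3, (h3 w hw).1]
            exact hd
          · rw [(hs2 v hv').1]
            exact h4 v hv'

end MonoTree

/-! ### From colourings and trees to bounds on the extremal numbers -/

lemma monoReach_mono {V : Type*} {k : ℕ} {T : Digraph V} {c : V → V → Fin k} {L L' : ℕ∞}
    (h : L ≤ L') (v : V) : monoReach T c L v ⊆ monoReach T c L' v := by
  rintro u ⟨a, j, hj, hw⟩
  exact ⟨a, j, hj.trans h, hw⟩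

/-- Some tournament with `n` vertices has a colouring with `k` colours in which no vertex reaches
more than `m` vertices by monochromatic walks with at most `L` edges. -/
def ReachBound (k : ℕ) (L : ℕ∞) (n m : ℕ) : Prop :=
  ∃ T : Digraph (Fin n), IsTournament T ∧ ∃ c : Fin n → Fin n → Fin k,
    ∀ v, (monoReach T c L v).ncard ≤ m

lemma ReachBound.mono {k : ℕ} {L L' : ℕ∞} {n m : ℕ} (h : L ≤ L') (hb : ReachBound k L' n m) :
    ReachBound k L n m := by
  obtain ⟨T, hT, c, hc⟩ := hb
  exact ⟨T, hT, c, fun v => (Set.ncard_le_ncard (monoReach_mono h v)).trans (hc v)⟩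

lemma ReachBound.fDepth_le {k ℓ n m : ℕ} (h : ReachBound k ℓ n m) : fDepth k ℓ n ≤ m := by
  obtain ⟨T, hT, c, hc⟩ := h
  refine le_trans (b := fDepthOf T k ℓ) (Nat.sInf_le ⟨T, hT, rfl⟩) (csSup_le' ?_)
  intro m' hm'
  obtain ⟨S, A, r, hA, hS, hmono, hd, hcard⟩ := hm' c
  refine hcard.trans (le_trans ?_ (hc r))
  rw [← Set.ncard_coe_finset]
  exact Set.ncard_le_ncard (hS.subset_monoReach hA hmono fun p hp => by exact_mod_cast hd p hp)

lemma ReachBound.fMin_le {k n m : ℕ} (h : ReachBound k ⊤ n m) : fMin k n ≤ m := by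
  obtain ⟨T, hT, c, hc⟩ := h
  refine le_trans (b := fOf T k) (Nat.sInf_le ⟨T, hT, rfl⟩) (csSup_le' ?_)
  intro m' hm'
  obtain ⟨S, A, r, hA, hS, hmono, hcard⟩ := hm' c
  refine hcard.trans (le_trans ?_ (hc r))
  rw [← Set.ncard_coe_finset]
  exact Set.ncard_le_ncard (hS.subset_monoReach hA hmono fun p hp => le_top)

lemma isTournament_lt (n : ℕ) : IsTournament (⟨(· < ·)⟩ : Digraph (Fin n)) where
  loopless v := lt_irrefl v
  adj_xor u v h := by
    rcases lt_or_gt_of_ne h with h | h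
    · exact Or.inl ⟨h, h.asymm⟩
    · exact Or.inr ⟨h, h.asymm⟩

lemma le_fDepthOf {k ℓ n m : ℕ} (hk : 0 < k) (T : Digraph (Fin n))
    (h : ∀ c : Fin n → Fin n → Fin k, ∃ r, ∃ t : MonoTree T c r,
      (∀ v ∈ t.verts, t.dep v ≤ ℓ) ∧ m ≤ t.verts.card) : m ≤ fDepthOf T k ℓ := by
  refine le_csSup ⟨n, ?_⟩ fun c => ?_
  · intro m' hm'
    obtain ⟨S, A, r, -, -, -, -, hcard⟩ := hm' fun _ _ => ⟨0, hk⟩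
    exact hcard.trans (by simpa using S.card_le_univ)
  · obtain ⟨r, t, ht, hcard⟩ := h c
    exact ⟨t.verts, t.toDigraph, r, t.toDigraph_le, t.isArborescence, t.isPathMonochromatic,
      t.depthAtMost ht, hcard⟩

lemma le_fDepth {k ℓ n m : ℕ} (hk : 0 < k)
    (h : ∀ T : Digraph (Fin n), IsTournament T → ∀ c : Fin n → Fin n → Fin k,
      ∃ r, ∃ t : MonoTree T c r, (∀ v ∈ t.verts, t.dep v ≤ ℓ) ∧ m ≤ t.verts.card) :
    m ≤ fDepth k ℓ n := by
  refine le_csInf ⟨_, _, isTournament_lt n, rfl⟩ ?_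
  rintro _ ⟨T, hT, rfl⟩
  exact le_fDepthOf hk T (h T hT)

lemma le_fMin {k n m : ℕ} (hk : 0 < k)
    (h : ∀ T : Digraph (Fin n), IsTournament T → ∀ c : Fin n → Fin n → Fin k,
      ∃ r, ∃ t : MonoTree T c r, m ≤ t.verts.card) : m ≤ fMin k n := by
  refine le_csInf ⟨_, _, isTournament_lt n, rfl⟩ ?_
  rintro _ ⟨T, hT, rfl⟩
  refine le_csSup ⟨n, ?_⟩ fun c => ?_
  · intro m' hm'
    obtain ⟨S, A, r, -, -, -, hcard⟩ := hm' fun _ _ => ⟨0, hk⟩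
    exact hcard.trans (by simpa using S.card_le_univ)
  · obtain ⟨r, t, hcard⟩ := h T hT c
    exact ⟨t.verts, t.toDigraph, r, t.toDigraph_le, t.isArborescence, t.isPathMonochromatic, hcard⟩

/-! ### Trees of depth one and two -/

section Shallow

variable {V : Type*} {k : ℕ}

lemma exists_star [Finite V] (T : Digraph V) (c : V → V → Fin k) (r : V) :
    ∃ t : MonoTree T c r, (∀ u, T.Adj r u → u ∈ t.verts) ∧ ∀ v ∈ t.verts, t.dep v ≤ 1 := by
  classical
  have := Fintype.ofFinite V
  obtain ⟨t, -, h, -, hd⟩ := (MonoTree.single T c r).exists_addLeaves (L := 1)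
    (fun v _ => Nat.zero_le 1) (Finset.univ.filter fun u => T.Adj r u) (fun u hu =>
      Or.inr ⟨r, (MonoTree.single T c r).root_mem, (Finset.mem_filter.1 hu).2, Nat.zero_lt_one,
        fun h => absurd rfl h⟩)
  exact ⟨t, fun u hu => h (by simpa using hu), hd⟩

/-- All vertices that are reached by monochromatic walks with at most two edges lie in a common
path-monochromatic tree: a vertex at depth one has its colour determined by the edge from the root,
so trees in different colours do not compete for it. -/
lemma exists_monoTree_two [Finite V] (T : Digraph V) (c : V → V → Fin k) (r : V) :
    ∃ t : MonoTree T c r, monoReach T c 2 r ⊆ t.verts ∧ ∀ v ∈ t.verts, t.dep v ≤ 2 := by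
  classical
  have := Fintype.ofFinite V
  obtain ⟨s, hs, hd⟩ := exists_star T c r
  obtain ⟨t, hst, h, -, hd'⟩ := s.exists_addLeaves (L := 2) (fun v hv => (hd v hv).trans one_le_two)
    (Finset.univ.filter fun u => u ∈ monoReach T c 2 r) (by
      intro u hu
      obtain ⟨a, j, hj, hw⟩ := (Finset.mem_filter.1 hu).2
      have hw : MonoWalk T c a 2 r u := hw.mono (by exact_mod_cast hj)
      have one : ∀ x, MonoWalk T c a 1 r x → x = r ∨ T.Adj r x ∧ c r x = a := by
        rintro x (rfl | ⟨w, rfl, h⟩)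
        · exact Or.inl rfl
        · exact Or.inr h
      rcases hw with hw | ⟨w, hw, hwu, hc⟩
      · rcases one u hw with rfl | ⟨h, -⟩
        · exact Or.inl s.root_mem
        · exact Or.inl (hs u h)
      · rcases one w hw with rfl | ⟨hrw, hcw⟩
        · exact Or.inl (hs u hwu)
        · refine Or.inr ⟨w, hs w hrw, hwu, (hd w (hs w hrw)).trans_lt one_lt_two, fun hne => ?_⟩
          have hpar : s.par w = r := by
            by_contra hp
            have h1 := s.dep_par w (hs w hrw) hne
            have h2 := s.dep_par _ (s.par_mem w (hs w hrw) hne) hp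
            have h3 := hd w (hs w hrw)
            omega
          rw [hpar, hcw, hc])
  exact ⟨t, fun u hu => h (by simpa using hu), hd'⟩

lemma reachBound_of_fDepth_two_le {k n m : ℕ} (hk : 0 < k) (h : fDepth k 2 n ≤ m) :
    ReachBound k 2 n m := by
  obtain ⟨T, hT, hm⟩ := Nat.sInf_mem (s := {m : ℕ | ∃ T : Digraph (Fin n), IsTournament T ∧
    m = fDepthOf T k 2}) ⟨_, _, isTournament_lt n, rfl⟩
  change fDepth k 2 n = _ at hm
  rw [hm] at h
  by_contra hcon
  refine absurd (le_fDepthOf (m := m + 1) (ℓ := 2) hk T fun c => ?_) (by omega)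
  have : ∃ v, m < (monoReach T c 2 v).ncard := by
    by_contra! hv
    exact hcon ⟨T, hT, c, hv⟩
  obtain ⟨v, hv⟩ := this
  obtain ⟨t, ht, hd⟩ := exists_monoTree_two T c v
  refine ⟨v, t, hd, hv.trans_le ?_⟩
  rw [← Set.ncard_coe_finset]
  exact Set.ncard_le_ncard ht

/-- Some vertex of a tournament dominates at least half of the other vertices. -/
lemma IsTournament.exists_half {n : ℕ} (hn : 0 < n) {T : Digraph (Fin n)} (hT : IsTournament T)
    (c : Fin n → Fin n → Fin k) :
    ∃ r, ∃ t : MonoTree T c r, (∀ v ∈ t.verts, t.dep v ≤ 1) ∧ n ≤ 2 * t.verts.card := by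
  classical
  have hdeg : ∀ v : Fin n, n = (Finset.univ.filter fun u => T.Adj v u).card +
      (Finset.univ.filter fun u => T.Adj u v).card + 1 := by
    intro v
    have h2 : (Finset.univ : Finset (Fin n)) = insert v
        ((Finset.univ.filter fun u => T.Adj v u) ∪ (Finset.univ.filter fun u => T.Adj u v)) := by
      ext u
      by_cases h : u = v
      · simp [h]
      · rcases hT.adj_xor u v h with h' | h' <;> simp [h'.1]
    have h3 := congrArg Finset.card h2
    rw [Finset.card_insert_of_notMem (by simp [hT.loopless]), Finset.card_union_of_disjoint,
      Finset.card_univ, Fintype.card_fin] at h3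
    · exact h3
    · rw [Finset.disjoint_filter]
      intro u _ h4 h5
      have hne : u ≠ v := by rintro rfl; exact hT.loopless _ h4
      rcases hT.adj_xor u v hne with h' | h'
      · exact h'.2 h4
      · exact h'.2 h5
  have hsum : ∑ v : Fin n, (Finset.univ.filter fun u => T.Adj v u).card =
      ∑ v : Fin n, (Finset.univ.filter fun u => T.Adj u v).card :=
    Finset.sum_card_bipartiteAbove_eq_sum_card_bipartiteBelow (s := Finset.univ)
      (t := Finset.univ) T.Adj
  obtain ⟨v, hv⟩ : ∃ v : Fin n, n ≤ 2 * ((Finset.univ.filter fun u => T.Adj v u).card + 1) := by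
    by_contra! hcon
    refine hsum.not_lt (Finset.sum_lt_sum_of_nonempty ⟨⟨0, hn⟩, Finset.mem_univ _⟩ fun v _ => ?_)
    have := hcon v
    have := hdeg v
    omega
  obtain ⟨t, ht, hd⟩ := exists_star T c v
  refine ⟨v, t, hd, ?_⟩
  have : insert v (Finset.univ.filter fun u => T.Adj v u) ⊆ t.verts :=
    Finset.insert_subset t.root_mem fun u hu => ht u (by simpa using hu)
  have := Finset.card_le_card this
  rw [Finset.card_insert_of_notMem (by simp [hT.loopless])] at this
  omega

end Shallow

/-! ### Blow-ups and the existence of limits -/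

/-- A map under which every edge is contracted or mapped to an edge of the same colour maps
monochromatic walks to monochromatic walks. -/
lemma MonoWalk.map {V W : Type*} {k : ℕ} {T : Digraph V} {c : V → V → Fin k} {T' : Digraph W}
    {c' : W → W → Fin k} (f : W → V)
    (hf : ∀ x y, T'.Adj x y → f x = f y ∨ T.Adj (f x) (f y) ∧ c (f x) (f y) = c' x y)
    {a : Fin k} {j : ℕ} {x y : W} (h : MonoWalk T' c' a j x y) : MonoWalk T c a j (f x) (f y) := by
  induction j generalizing y with
  | zero => exact congrArg f h
  | succ j ih =>
    rcases h with h | ⟨w, hw, hadj, hc⟩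
    · exact Or.inl (ih h)
    · rcases hf w y hadj with h | ⟨h1, h2⟩
      · exact Or.inl (h ▸ ih hw)
      · exact Or.inr ⟨f w, ih hw, h1, h2.trans hc⟩

/-- A colouring of a tournament on any vertex type with `n` elements gives a bound on the reach
numbers for `n`. -/
lemma ReachBound.of_fintype {V : Type*} [Fintype V] {k : ℕ} {L : ℕ∞} {n m : ℕ}
    (hn : Fintype.card V = n) {T : Digraph V} (hT : IsTournament T) (c : V → V → Fin k)
    (hc : ∀ v, (monoReach T c L v).ncard ≤ m) : ReachBound k L n m := by
  let e : Fin n ≃ V := (Fintype.equivFinOfCardEq hn).symm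
  refine ⟨⟨fun i j => T.Adj (e i) (e j)⟩, ⟨fun v => hT.loopless _, fun u v h =>
    hT.adj_xor _ _ (e.injective.ne h)⟩, fun i j => c (e i) (e j), fun v => le_trans ?_ (hc (e v))⟩
  refine Set.ncard_le_ncard_of_injOn e ?_ e.injective.injOn
  rintro u ⟨a, j, hj, hw⟩
  exact ⟨a, j, hj, hw.map (T := T) (c := c) e fun x y h => Or.inr ⟨h, rfl⟩⟩

lemma ReachBound.blowUp {k : ℕ} {L : ℕ∞} {n m : ℕ} (h : ReachBound k L n m) (q : ℕ) :
    ReachBound k L (n * q) (m * q) := by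
  obtain ⟨T, hT, c, hc⟩ := h
  let T' : Digraph (Fin n × Fin q) := ⟨fun x y => T.Adj x.1 y.1 ∨ x.1 = y.1 ∧ x.2 < y.2⟩
  refine ReachBound.of_fintype (T := T') (by simp) ⟨?_, ?_⟩ (fun x y => c x.1 y.1) fun v => ?_
  · rintro v (h | h)
    · exact hT.loopless _ h
    · exact lt_irrefl _ h.2
  · rintro ⟨u, i⟩ ⟨v, j⟩ h
    by_cases huv : u = v
    · subst huv
      have hij : i ≠ j := fun h' => h (by rw [h'])
      simp only [T', hT.loopless, false_or, true_and]
      rcases lt_or_gt_of_ne hij with h | h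
      · exact Or.inl ⟨h, h.asymm⟩
      · exact Or.inr ⟨h, h.asymm⟩
    · simpa [T', huv, Ne.symm huv] using hT.adj_xor u v huv
  · have hsub : monoReach T' (fun x y => c x.1 y.1) L v ⊆
        monoReach T c L v.1 ×ˢ (Set.univ : Set (Fin q)) := by
      rintro u ⟨a, j, hj, hw⟩
      refine ⟨⟨a, j, hj, hw.map Prod.fst fun x y h => ?_⟩, trivial⟩
      rcases h with h | h
      · exact Or.inr ⟨h, rfl⟩
      · exact Or.inl h.1
    refine (Set.ncard_le_ncard hsub).trans ?_
    rw [Set.ncard_prod, Set.ncard_univ, Nat.card_eq_fintype_card, Fintype.card_fin]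
    exact Nat.mul_le_mul_right _ (hc _)

/-- A vertex that is dominated by all others increases the reach of each vertex by at most one. -/
lemma ReachBound.succ {k : ℕ} (hk : 0 < k) {L : ℕ∞} {n m : ℕ} (h : ReachBound k L n m) :
    ReachBound k L (n + 1) (m + 1) := by
  obtain ⟨T, hT, c, hc⟩ := h
  let T' : Digraph (Option (Fin n)) := ⟨fun x y => ∃ u, x = some u ∧ ∀ v, y = some v → T.Adj u v⟩
  let c' : Option (Fin n) → Option (Fin n) → Fin k := fun x y =>
    x.elim ⟨0, hk⟩ fun u => y.elim ⟨0, hk⟩ fun v => c u v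
  refine ReachBound.of_fintype (T := T') (by simp) ⟨?_, ?_⟩ c' fun v => ?_
  · rintro v ⟨u, rfl, h⟩
    exact hT.loopless _ (h u rfl)
  · rintro (_ | u) (_ | v) h
    · exact absurd rfl h
    · exact Or.inr ⟨⟨v, rfl, by simp⟩, by rintro ⟨u, hu, -⟩; simp at hu⟩
    · exact Or.inl ⟨⟨u, rfl, by simp⟩, by rintro ⟨u, hu, -⟩; simp at hu⟩
    · simpa [T'] using hT.adj_xor u v (fun h' => h (congrArg some h'))
  · rcases v with _ | v
    · have hsub : monoReach T' c' L none ⊆ {none} := by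
        rintro u ⟨a, j, -, hw⟩
        induction j generalizing u with
        | zero => exact hw
        | succ j ih =>
          rcases hw with hw | ⟨w, hw, ⟨x, hx, -⟩, -⟩
          · exact ih hw
          · rw [ih hw] at hx
            simp at hx
      refine (Set.ncard_le_ncard hsub).trans ?_
      simp
    · have hsub : monoReach T' c' L (some v) ⊆ insert none (some '' monoReach T c L v) := by
        have key : ∀ (a : Fin k) (j : ℕ) (u : Fin n), MonoWalk T' c' a j (some v) (some u) →
            MonoWalk T c a j v u := by
          intro a j
          induction j with
          | zero => intro u hw; exact Option.some_injective _ hw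
          | succ j ih =>
            rintro u (hw | ⟨w, hw, ⟨x, rfl, hx⟩, hc⟩)
            · exact Or.inl (ih u hw)
            · exact Or.inr ⟨x, ih x hw, hx u rfl, hc⟩
        rintro (_ | u) ⟨a, j, hj, hw⟩
        · exact Or.inl rfl
        · exact Or.inr ⟨u, ⟨a, j, hj, key a j u hw⟩, rfl⟩
      refine (Set.ncard_le_ncard hsub).trans ((Set.ncard_insert_le _ _).trans ?_)
      rw [Set.ncard_image_of_injective _ (Option.some_injective _)]
      exact Nat.add_le_add_right (hc v) 1

lemma ReachBound.add {k : ℕ} (hk : 0 < k) {L : ℕ∞} {n m : ℕ} (h : ReachBound k L n m) (s : ℕ) :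
    ReachBound k L (n + s) (m + s) := by
  induction s with
  | zero => exact h
  | succ s ih => exact ih.succ hk

/-- A function that satisfies all bounds coming from reach numbers, and lies asymptotically above
`x`, has density `x` as soon as some reach bounds have a density arbitrarily close to `x`: a good
colouring for one number of vertices can be blown up to any larger number. -/
lemma tendsto_of_reachBound {k : ℕ} (hk : 0 < k) {L : ℕ∞} {F : ℕ → ℕ} {x : ℝ}
    (hF : ∀ n m, ReachBound k L n m → F n ≤ m)
    (hlow : ∀ ε > 0, ∀ᶠ N : ℕ in atTop, x - ε < (F N : ℝ) / N)
    (hup : ∀ ε > 0, ∃ n m : ℕ, 0 < n ∧ ReachBound k L n m ∧ (m : ℝ) / n < x + ε) :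
    Tendsto (fun N : ℕ => (F N : ℝ) / N) atTop (𝓝 x) := by
  rw [Metric.tendsto_nhds]
  intro ε hε
  obtain ⟨n, m, hn, hb, hnm⟩ := hup (ε / 2) (by positivity)
  have hlim : ∀ᶠ N : ℕ in atTop, (n : ℝ) / N < ε / 2 :=
    (tendsto_const_div_atTop_nhds_zero_nat (n : ℝ)).eventually_lt_const (by positivity)
  filter_upwards [hlow ε hε, hlim, eventually_gt_atTop 0] with N h1 h2 hN
  rw [Real.dist_eq, abs_lt]
  refine ⟨by linarith, ?_⟩
  have h3 : F N ≤ m * (N / n) + N % n := by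
    refine hF N _ ?_
    have := (hb.blowUp (N / n)).add hk (N % n)
    rwa [Nat.div_add_mod] at this
  have hN' : (0 : ℝ) < N := by exact_mod_cast hN
  have hn' : (0 : ℝ) < n := by exact_mod_cast hn
  have h4 : (F N : ℝ) ≤ m * ((N : ℝ) / n) + n := by
    have h5 : ((N / n : ℕ) : ℝ) ≤ (N : ℝ) / n := Nat.cast_div_le
    have h6 : ((N % n : ℕ) : ℝ) ≤ n := by exact_mod_cast (Nat.mod_lt N hn).le
    calc (F N : ℝ) ≤ ((m * (N / n) + N % n : ℕ) : ℝ) := by exact_mod_cast h3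
      _ = m * ((N / n : ℕ) : ℝ) + ((N % n : ℕ) : ℝ) := by push_cast; ring
      _ ≤ _ := add_le_add (mul_le_mul_of_nonneg_left h5 (Nat.cast_nonneg m)) h6
  have h5 : (F N : ℝ) / N ≤ m / n + n / N := by
    rw [div_le_iff₀ hN']
    calc (F N : ℝ) ≤ m * ((N : ℝ) / n) + n := h4
      _ = (m / n + n / N) * N := by field_simp
  linarith

/-! ### Colourings in which every vertex has a small reach -/

/-- Substituting a coloured tournament into each vertex of a cyclic triangle whose edges have
three different colours: a walk that leaves a part stays in the next one. -/
lemma ReachBound.triangle {k : ℕ} (hk : 3 ≤ k) {L : ℕ∞} {n m : ℕ} (h : ReachBound k L n m) :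
    ReachBound k L (3 * n) (n + m) := by
  obtain ⟨T, hT, c, hc⟩ := h
  let T' : Digraph (Fin 3 × Fin n) := ⟨fun x y => y.1 = x.1 + 1 ∨ x.1 = y.1 ∧ T.Adj x.2 y.2⟩
  let c' : Fin 3 × Fin n → Fin 3 × Fin n → Fin k := fun x y =>
    if x.1 = y.1 then c x.2 y.2 else Fin.castLE hk x.1
  have hne : ∀ i : Fin 3, i ≠ i + 1 := by decide
  refine ReachBound.of_fintype (T := T') (by simp) ⟨?_, ?_⟩ c' fun v => ?_
  · rintro v (h | h)
    · exact hne _ h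
    · exact hT.loopless _ h.2
  · rintro ⟨i, u⟩ ⟨j, v⟩ h
    by_cases hij : i = j
    · subst hij
      simpa [T', hne] using hT.adj_xor u v (fun h' => h (by rw [h']))
    · have : ∀ i j : Fin 3, i ≠ j → Xor (j = i + 1) (i = j + 1) := by decide
      simpa [T', hij, Ne.symm hij] using this i j hij
  · obtain ⟨i, x⟩ := v
    have key : ∀ (a : Fin k) (j : ℕ) (y : Fin 3 × Fin n), MonoWalk T' c' a j (i, x) y →
        y.1 = i ∧ MonoWalk T c a j x y.2 ∨ y.1 = i + 1 ∧ a = Fin.castLE hk i := by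
      intro a j
      induction j with
      | zero => rintro y rfl; exact Or.inl ⟨rfl, rfl⟩
      | succ j ih =>
        rintro y (hw | ⟨w, hw, hadj, hcol⟩)
        · rcases ih y hw with h | h
          · exact Or.inl ⟨h.1, Or.inl h.2⟩
          · exact Or.inr h
        · rcases hadj with hadj | ⟨hadj, hT'⟩
          · have hcol' : Fin.castLE hk w.1 = a := by
              rw [← hcol]
              simp only [c', hadj, if_neg (hne w.1)]
            rcases ih w hw with h | h
            · rw [h.1] at hadj hcol'
              exact Or.inr ⟨hadj, hcol'.symm⟩
            · rw [h.2, h.1] at hcol'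
              exact absurd (Fin.castLE_injective hk hcol').symm (hne i)
          · rcases ih w hw with h | h
            · refine Or.inl ⟨hadj ▸ h.1, Or.inr ⟨w.2, h.2, hT', ?_⟩⟩
              simpa [c', hadj] using hcol
            · exact Or.inr ⟨hadj ▸ h.1, h.2⟩
    have hsub : monoReach T' c' L (i, x) ⊆
        ({i + 1} : Set (Fin 3)) ×ˢ (Set.univ : Set (Fin n)) ∪
          ({i} : Set (Fin 3)) ×ˢ monoReach T c L x := by
      rintro ⟨i', y⟩ ⟨a, j, hj, hw⟩
      rcases key a j _ hw with h | h
      · exact Or.inr ⟨h.1, a, j, hj, h.2⟩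
      · exact Or.inl ⟨h.1, trivial⟩
    refine (Set.ncard_le_ncard hsub).trans ((Set.ncard_union_le _ _).trans ?_)
    rw [Set.ncard_prod, Set.ncard_prod, Set.ncard_univ, Nat.card_eq_fintype_card,
      Fintype.card_fin, Set.ncard_singleton, Set.ncard_singleton, one_mul, one_mul]
    exact Nat.add_le_add_left (hc x) n

lemma reachBound_three_pow {k : ℕ} (hk : 3 ≤ k) (t : ℕ) :
    ∃ m, 2 * m = 3 ^ t + 1 ∧ ReachBound k ⊤ (3 ^ t) m := by
  induction t with
  | zero =>
    refine ⟨1, rfl, ⟨(· < ·)⟩, isTournament_lt _, fun _ _ => ⟨0, by omega⟩, fun v => ?_⟩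
    exact (Set.ncard_le_ncard (Set.subset_univ _)).trans (by simp [Set.ncard_univ])
  | succ t ih =>
    obtain ⟨m, hm, hb⟩ := ih
    refine ⟨3 ^ t + m, ?_, ?_⟩
    · rw [pow_succ]; omega
    · rw [pow_succ, mul_comm]
      exact hb.triangle hk

/-- On `n = (ℓ + 1) r + 1` cyclically ordered vertices, let the edges between vertices at cyclic
distance at most `r` go backwards and have colour `0`, and let the other pairs have colour `1` and
go forwards in the linear order. No vertex reaches any of the `r` vertices that follow it
cyclically: at least `ℓ + 1` steps of colour `0` are needed for this, and steps of colour `1`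
do not help at all. -/
lemma reachBound_cyclic {ℓ : ℕ} (hℓ : 1 ≤ ℓ) (r : ℕ) :
    ReachBound 2 ℓ ((ℓ + 1) * r + 1) (ℓ * r + 1) := by
  set n := (ℓ + 1) * r + 1 with hn
  have hn' : n = ℓ * r + r + 1 := by rw [hn]; ring
  have hr : r ≤ ℓ * r := Nat.le_mul_of_pos_left r hℓ
  let T : Digraph (Fin n) :=
    ⟨fun x y => (y : ℕ) < x ∧ (x : ℕ) ≤ y + r ∨ (x : ℕ) + r < y⟩
  let c : Fin n → Fin n → Fin 2 := fun x y => if (x : ℕ) < y ∧ (y : ℕ) + r < x + n then 1 else 0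
  have hstep : ∀ x y, T.Adj x y → (c x y = 0 → ∃ s ≤ r, (y : ℕ) + s = x ∨ (y : ℕ) + s = x + n) ∧
      (c x y = 1 → (x : ℕ) + r < y) := by
    intro x y hxy
    have hx := x.2
    have hy := y.2
    simp only [T] at hxy
    simp only [c]
    split_ifs with h
    · refine ⟨fun h' => absurd h' (by decide), fun _ => by omega⟩
    · refine ⟨fun _ => ?_, fun h' => absurd h' (by decide)⟩
      rcases hxy with hxy | hxy
      · exact ⟨x - y, by omega, by omega⟩
      · exact ⟨x + n - y, by omega, by omega⟩
  have h0 : ∀ (j : ℕ), j ≤ ℓ → ∀ v u, MonoWalk T c 0 j v u →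
      ∃ s ≤ j * r, (u : ℕ) + s = v ∨ (u : ℕ) + s = v + n := by
    intro j
    induction j with
    | zero => rintro - v u rfl; exact ⟨0, by omega, by omega⟩
    | succ j ih =>
      intro hj v u hw
      have hjr : (j + 1) * r ≤ ℓ * r := Nat.mul_le_mul_right r hj
      rw [add_mul, one_mul] at hjr ⊢
      rcases hw with hw | ⟨w, hw, hadj, hc⟩
      · obtain ⟨s, hs, h⟩ := ih (by omega) v u hw
        exact ⟨s, by omega, h⟩
      · obtain ⟨s, hs, h⟩ := ih (by omega) v w hw
        obtain ⟨s', hs', h'⟩ := (hstep w u hadj).1 hc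
        have hu := u.2
        exact ⟨s + s', by omega, by omega⟩
  have h1 : ∀ (j : ℕ) v u, MonoWalk T c 1 j v u → u = v ∨ (v : ℕ) + r < u := by
    intro j
    induction j with
    | zero => rintro v u rfl; exact Or.inl rfl
    | succ j ih =>
      rintro v u (hw | ⟨w, hw, hadj, hc⟩)
      · exact ih v u hw
      · have := (hstep w u hadj).2 hc
        rcases ih v w hw with rfl | h
        · exact Or.inr this
        · exact Or.inr (by omega)
  refine ⟨T, ⟨fun v h => ?_, fun u v h => ?_⟩, c, fun v => ?_⟩
  · simp only [T] at h; omega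
  · have : (u : ℕ) ≠ v := fun h' => h (Fin.ext h')
    simp only [T, Xor]
    omega
  · have hsub : monoReach T c ℓ v ⊆
        ((Finset.range (ℓ * r + 1)).image
          fun s => (⟨(v + n - s) % n, Nat.mod_lt _ (by omega)⟩ : Fin n) : Finset (Fin n)) := by
      rintro u ⟨a, j, hj, hw⟩
      have hj : j ≤ ℓ := by exact_mod_cast hj
      have hu := u.2
      have hv := v.2
      have : ∃ s ≤ ℓ * r, (u : ℕ) + s = v ∨ (u : ℕ) + s = v + n := by
        fin_cases a
        · obtain ⟨s, hs, h⟩ := h0 j hj v u hw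
          exact ⟨s, hs.trans (Nat.mul_le_mul_right r hj), h⟩
        · rcases h1 j v u hw with rfl | h
          · exact ⟨0, by omega, by omega⟩
          · exact ⟨v + n - u, by omega, by omega⟩
      obtain ⟨s, hs, h⟩ := this
      simp only [Finset.coe_image, Set.mem_image, Finset.coe_range, Set.mem_Iio]
      refine ⟨s, by omega, Fin.ext ?_⟩
      change ((v : ℕ) + n - s) % n = u
      rcases h with h | h
      · rw [show (v : ℕ) + n - s = u + n by omega, Nat.add_mod_right, Nat.mod_eq_of_lt hu]
      · rw [show (v : ℕ) + n - s = u by omega, Nat.mod_eq_of_lt hu]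
    refine (Set.ncard_le_ncard hsub).trans ?_
    rw [Set.ncard_coe_finset]
    exact Finset.card_image_le.trans (by simp)

/-! ### Shen's theorem on directed triangles -/

section Shen

variable {V : Type*} [DecidableEq V]

/-- The local inequality in Shen's argument, for an edge `(u, v)` of an `r`-out-regular digraph
without directed triangles on `S`, given by the out-neighbourhoods `N`. The out-neighbours of `v`,
its in-neighbours, the in-neighbours of `u` that are not in-neighbours of `v`, and the
out-neighbours outside `N v` of a suitable common out-neighbour of `u` and `v` are pairwise disjoint. -/
lemma shen_edge_inequality {α : ℝ} {S : Finset V} {N : V → Finset V} {r : ℕ}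
    (hNS : ∀ u ∈ S, N u ⊆ S) (hr : ∀ u ∈ S, (N u).card = r)
    (hasymm : ∀ u ∈ S, ∀ v ∈ N u, u ∉ N v)
    (htri : ∀ u ∈ S, ∀ v ∈ N u, ∀ w ∈ N v, u ∉ N w)
    (hind : ∀ M ⊆ S, M ≠ S → M.Nonempty → ∃ w ∈ M, ((M ∩ N w).card : ℝ) < α * M.card)
    {u v : V} (hu : u ∈ S) (hv : v ∈ N u) :
    (r : ℝ) + (S.filter fun x => v ∈ N x).card +
      ((S.filter fun x => u ∈ N x).card - (S.filter fun x => u ∈ N x ∧ v ∈ N x).card) +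
      (1 - α) * (N u ∩ N v).card ≤ S.card := by
  have hvS : v ∈ S := hNS u hu hv
  obtain ⟨X, hXS, hX1, hX2, hX3, hXcard⟩ : ∃ X ⊆ S, Disjoint X (N v) ∧ (∀ x ∈ X, v ∉ N x) ∧
      (∀ x ∈ X, u ∉ N x) ∧ (1 - α) * (N u ∩ N v).card ≤ (X.card : ℝ) := by
    rcases (N u ∩ N v).eq_empty_or_nonempty with h | h
    · exact ⟨∅, by simp, by simp, by simp, by simp, by simp [h]⟩
    · have huN : u ∉ N u := fun h' => hasymm u hu u h' h'
      obtain ⟨w, hw, hlt⟩ := hind _ (Finset.inter_subset_left.trans (hNS u hu))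
        (fun h' => huN (Finset.inter_subset_left (h'.symm ▸ hu))) h
      rw [Finset.mem_inter] at hw
      refine ⟨N w \ N v, Finset.sdiff_subset.trans (hNS w (hNS u hu hw.1)),
        Finset.sdiff_disjoint, fun x hx => htri v hvS w hw.2 x (Finset.sdiff_subset hx),
        fun x hx => htri u hu w hw.1 x (Finset.sdiff_subset hx), ?_⟩
      have h1 : (N w).card = r := hr w (hNS u hu hw.1)
      have h2 : (N v).card = r := hr v hvS
      have h3 : (N w ∩ N v).card ≤ (N u ∩ N v ∩ N w).card + (N v \ N u).card := by
        rw [← Finset.card_union_of_disjoint]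
        · refine Finset.card_le_card fun x hx => ?_
          simp only [Finset.mem_union, Finset.mem_inter, Finset.mem_sdiff] at hx ⊢
          tauto
        · rw [Finset.disjoint_left]
          intro x hx hx'
          simp only [Finset.mem_inter, Finset.mem_sdiff] at hx hx'
          exact hx'.2 hx.1.1
      have h4 := Finset.card_sdiff_add_card_inter (N w) (N v)
      have h5 := Finset.card_sdiff_add_card_inter (N v) (N u)
      rw [Finset.inter_comm (N v) (N u)] at h5
      have h3' : ((N w ∩ N v).card : ℝ) ≤ (N u ∩ N v ∩ N w).card + (N v \ N u).card := by
        exact_mod_cast h3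
      have h4' : ((N w \ N v).card : ℝ) + (N w ∩ N v).card = r := by exact_mod_cast h4.trans h1
      have h5' : ((N v \ N u).card : ℝ) + (N u ∩ N v).card = r := by exact_mod_cast h5.trans h2
      linarith
  set I := S.filter fun x => v ∈ N x with hI
  set J := S.filter fun x => u ∈ N x ∧ v ∉ N x with hJ
  have hd1 : Disjoint X (N v) := hX1
  have hd2 : Disjoint (X ∪ N v) I := by
    rw [Finset.disjoint_left]
    intro x hx hxI
    have hxI := (Finset.mem_filter.1 hxI).2
    rcases Finset.mem_union.1 hx with hx | hx
    · exact hX2 x hx hxI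
    · exact hasymm v hvS x hx hxI
  have hd3 : Disjoint (X ∪ N v ∪ I) J := by
    rw [Finset.disjoint_left]
    intro x hx hxJ
    obtain ⟨-, hxu, hxv⟩ := Finset.mem_filter.1 hxJ
    rcases Finset.mem_union.1 hx with hx | hx
    · rcases Finset.mem_union.1 hx with hx | hx
      · exact hX3 x hx hxu
      · exact htri u hu v hv x hx hxu
    · exact hxv (Finset.mem_filter.1 hx).2
  have hcard : (X ∪ N v ∪ I ∪ J).card ≤ S.card := by
    refine Finset.card_le_card ?_
    exact Finset.union_subset (Finset.union_subset (Finset.union_subset hXS (hNS v hvS))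
      (Finset.filter_subset _ _)) (Finset.filter_subset _ _)
  rw [Finset.card_union_of_disjoint hd3, Finset.card_union_of_disjoint hd2,
    Finset.card_union_of_disjoint hd1, hr v hvS] at hcard
  have hJcard : J.card + (S.filter fun x => u ∈ N x ∧ v ∈ N x).card =
      (S.filter fun x => u ∈ N x).card := by
    rw [add_comm, ← Finset.card_filter_add_card_filter_not (s := S.filter fun x => u ∈ N x)
      (fun x => v ∈ N x), Finset.filter_filter, Finset.filter_filter]
  have hcard' : (X.card : ℝ) + r + I.card + J.card ≤ S.card := by exact_mod_cast hcard
  have hJ' : (J.card : ℝ) + (S.filter fun x => u ∈ N x ∧ v ∈ N x).card =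
      (S.filter fun x => u ∈ N x).card := by exact_mod_cast hJcard
  linarith

/-- The sum of the local inequalities over all edges. The transitive triangles are counted once
by their first edges and once by their last ones. -/
lemma shen_global_inequality {α : ℝ} (hα : 0 ≤ α) {S : Finset V} {N : V → Finset V} {r : ℕ}
    (hr0 : 0 < r) (hS : S.Nonempty)
    (hNS : ∀ u ∈ S, N u ⊆ S) (hr : ∀ u ∈ S, (N u).card = r)
    (hasymm : ∀ u ∈ S, ∀ v ∈ N u, u ∉ N v)
    (hedge : ∀ u ∈ S, ∀ v ∈ N u, (r : ℝ) + (S.filter fun x => v ∈ N x).card +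
      ((S.filter fun x => u ∈ N x).card - (S.filter fun x => u ∈ N x ∧ v ∈ N x).card) +
      (1 - α) * (N u ∩ N v).card ≤ S.card) :
    (3 : ℝ) * r - α * (r - 1) / 2 ≤ S.card := by
  set n : ℝ := (S.card : ℝ) with hn
  have hn0 : 0 < n := by rw [hn]; exact_mod_cast hS.card_pos
  have hr0' : (0 : ℝ) < r := by exact_mod_cast hr0
  let e : V → V → ℝ := fun u v => if v ∈ N u then 1 else 0
  have he0 : ∀ u v, 0 ≤ e u v := fun u v => by simp only [e]; split_ifs <;> norm_num
  have hout : ∀ u ∈ S, ∑ v ∈ S, e u v = r := by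
    intro u hu
    simp only [e]
    rw [Finset.sum_boole, Finset.filter_mem_eq_inter, Finset.inter_eq_right.2 (hNS u hu), hr u hu]
  let d : V → ℝ := fun v => ∑ u ∈ S, e u v
  have hd : ∀ v, ((S.filter fun x => v ∈ N x).card : ℝ) = d v := by
    intro v
    simp only [d, e]
    rw [Finset.sum_boole]
  have hdsum : ∑ v ∈ S, d v = n * r := by
    simp only [d]
    rw [Finset.sum_comm, Finset.sum_congr rfl hout, Finset.sum_const, nsmul_eq_mul]
  have hinn : ∀ u v, ((S.filter fun x => u ∈ N x ∧ v ∈ N x).card : ℝ) =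
      ∑ w ∈ S, e w u * e w v := by
    intro u v
    simp only [e]
    rw [← Finset.sum_boole]
    refine Finset.sum_congr rfl fun w _ => ?_
    by_cases h1 : u ∈ N w <;> by_cases h2 : v ∈ N w <;> simp [h1, h2]
  have hcommon : ∀ u ∈ S, ∀ v, ((N u ∩ N v).card : ℝ) = ∑ w ∈ S, e u w * e v w := by
    intro u hu v
    have : N u ∩ N v = S.filter fun w => w ∈ N u ∧ w ∈ N v := by
      ext w
      simp only [Finset.mem_inter, Finset.mem_filter]
      exact ⟨fun h => ⟨hNS u hu h.1, h⟩, fun h => h.2⟩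
    rw [this]
    simp only [e]
    rw [← Finset.sum_boole]
    refine Finset.sum_congr rfl fun w _ => ?_
    by_cases h1 : w ∈ N u <;> by_cases h2 : w ∈ N v <;> simp [h1, h2]
  set t : ℝ := ∑ u ∈ S, ∑ v ∈ S, e u v * ∑ w ∈ S, e u w * e v w with ht
  have ht' : ∑ u ∈ S, ∑ v ∈ S, e u v * ∑ w ∈ S, e w u * e w v = t := by
    rw [ht]
    simp only [Finset.mul_sum]
    calc ∑ u ∈ S, ∑ v ∈ S, ∑ w ∈ S, e u v * (e w u * e w v)
        = ∑ u ∈ S, ∑ w ∈ S, ∑ v ∈ S, e u v * (e w u * e w v) :=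
          Finset.sum_congr rfl fun u _ => Finset.sum_comm
      _ = ∑ w ∈ S, ∑ u ∈ S, ∑ v ∈ S, e u v * (e w u * e w v) := Finset.sum_comm
      _ = _ := Finset.sum_congr rfl fun w _ => Finset.sum_congr rfl fun u _ =>
          Finset.sum_congr rfl fun v _ => by ring
  have hsum : ∑ u ∈ S, ∑ v ∈ S, e u v * (r + d v + (d u - ∑ w ∈ S, e w u * e w v) +
      (1 - α) * ∑ w ∈ S, e u w * e v w) ≤ ∑ u ∈ S, ∑ v ∈ S, e u v * n := by
    refine Finset.sum_le_sum fun u hu => Finset.sum_le_sum fun v _ => ?_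
    by_cases huv : v ∈ N u
    · have := hedge u hu v huv
      rw [hd, hd, hinn, hcommon u hu] at this
      exact mul_le_mul_of_nonneg_left this (he0 u v)
    · simp [e, huv]
  have hright : ∑ u ∈ S, ∑ v ∈ S, e u v * n = n * r * n := by
    simp only [← Finset.sum_mul]
    rw [Finset.sum_congr rfl hout, Finset.sum_const, nsmul_eq_mul]
  have hA : ∑ u ∈ S, ∑ v ∈ S, e u v * (r : ℝ) = n * r * r := by
    simp only [← Finset.sum_mul]
    rw [Finset.sum_congr rfl hout, Finset.sum_const, nsmul_eq_mul]
  have hB : ∑ u ∈ S, ∑ v ∈ S, e u v * d v = ∑ v ∈ S, d v ^ 2 := by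
    rw [Finset.sum_comm]
    refine Finset.sum_congr rfl fun v _ => ?_
    rw [← Finset.sum_mul, sq]
  have hC : ∑ u ∈ S, ∑ v ∈ S, e u v * d u = n * r * r := by
    simp only [← Finset.sum_mul]
    rw [← hdsum, Finset.sum_mul]
    exact Finset.sum_congr rfl fun u hu => by rw [hout u hu, mul_comm]
  have hleft : ∑ u ∈ S, ∑ v ∈ S, e u v * (r + d v + (d u - ∑ w ∈ S, e w u * e w v) +
      (1 - α) * ∑ w ∈ S, e u w * e v w) =
      n * r * r + ∑ v ∈ S, d v ^ 2 + (n * r * r - t) + (1 - α) * t := by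
    have hscale : ∑ u ∈ S, ∑ v ∈ S, e u v * ((1 - α) * ∑ w ∈ S, e u w * e v w) = (1 - α) * t := by
      rw [ht, Finset.mul_sum]
      refine Finset.sum_congr rfl fun u _ => ?_
      rw [Finset.mul_sum]
      exact Finset.sum_congr rfl fun v _ => by ring
    rw [← hB, ← hscale, ← ht']
    nth_rewrite 1 [← hA]
    rw [← hC]
    simp only [mul_add, mul_sub, Finset.sum_add_distrib, Finset.sum_sub_distrib]
  have hcs : n * (r * r) ≤ ∑ v ∈ S, d v ^ 2 := by
    have := sq_sum_le_card_mul_sum_sq (s := S) (f := d)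
    rw [hdsum, ← hn] at this
    refine le_of_mul_le_mul_left ?_ hn0
    calc n * (n * (r * r)) = (n * r) ^ 2 := by ring
      _ ≤ _ := this
  -- at most one of the two pairs `(v, w)`, `(w, v)` of out-neighbours of `u` is an edge
  have htle : t ≤ n * ((r * r - r) / 2) := by
    have hu : ∀ u ∈ S, ∑ v ∈ S, e u v * ∑ w ∈ S, e u w * e v w ≤ ((r : ℝ) * r - r) / 2 := by
      intro u hu
      have h1 : ∑ v ∈ S, e u v * ∑ w ∈ S, e u w * e v w =
          ∑ v ∈ S, ∑ w ∈ S, e u v * e u w * e v w := by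
        refine Finset.sum_congr rfl fun v _ => ?_
        rw [Finset.mul_sum]
        exact Finset.sum_congr rfl fun w _ => by ring
      have h2 : ∑ v ∈ S, ∑ w ∈ S, e u v * e u w * e v w =
          ∑ v ∈ S, ∑ w ∈ S, e u v * e u w * e w v := by
        rw [Finset.sum_comm]
        exact Finset.sum_congr rfl fun v _ => Finset.sum_congr rfl fun w _ => by ring
      have h3 : ∑ v ∈ S, ∑ w ∈ S, e u v * e u w * e v w +
          ∑ v ∈ S, ∑ w ∈ S, e u v * e u w * e w v ≤
          ∑ v ∈ S, ∑ w ∈ S, (e u v * e u w - if v = w then e u v else 0) := by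
        rw [← Finset.sum_add_distrib]
        refine Finset.sum_le_sum fun v hv => ?_
        rw [← Finset.sum_add_distrib]
        refine Finset.sum_le_sum fun w hw => ?_
        rw [← mul_add]
        by_cases hvw : v = w
        · subst hvw
          have : v ∉ N v := fun h => hasymm v hv v h h
          by_cases h : v ∈ N u <;> simp [e, this, h]
        · rw [if_neg hvw, sub_zero]
          refine mul_le_of_le_one_right (mul_nonneg (he0 _ _) (he0 _ _)) ?_
          by_cases h : w ∈ N v
          · simp [e, h, hasymm v hv w h]
          · simp only [e, h, if_false, zero_add]
            split_ifs <;> norm_num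
      have h4 : ∑ v ∈ S, ∑ w ∈ S, (e u v * e u w - if v = w then e u v else 0) =
          (r : ℝ) * r - r := by
        simp only [Finset.sum_sub_distrib, ← Finset.mul_sum, ← Finset.sum_mul, hout u hu]
        congr 1
        rw [← hout u hu]
        exact Finset.sum_congr rfl fun v hv => by simp [hv]
      rw [h1]
      linarith
    calc t ≤ ∑ u ∈ S, ((r : ℝ) * r - r) / 2 := Finset.sum_le_sum hu
      _ = _ := by rw [Finset.sum_const, nsmul_eq_mul]
  rw [hright, hleft] at hsum
  have hfin : n * r * (3 * r - α * (r - 1) / 2) ≤ n * r * n := by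
    have := mul_le_mul_of_nonneg_left htle hα
    calc n * r * (3 * r - α * (r - 1) / 2)
        = n * r * r + n * (r * r) + n * r * r - α * (n * ((r * r - r) / 2)) := by ring
      _ ≤ n * r * r + ∑ v ∈ S, d v ^ 2 + n * r * r - α * t := by linarith
      _ = n * r * r + ∑ v ∈ S, d v ^ 2 + (n * r * r - t) + (1 - α) * t := by ring
      _ ≤ _ := hsum
  exact le_of_mul_le_mul_left hfin (mul_pos hn0 hr0')

/-- **Shen's theorem**: a digraph without directed cycles of length at most three has a vertex
whose out-degree is less than `3 - √7` times the number of vertices. -/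
theorem exists_outdegree_lt (D : V → V → Prop) [DecidableRel D] (hasymm : ∀ u v, D u v → ¬ D v u)
    (htri : ∀ u v w, D u v → D v w → ¬ D w u) (S : Finset V) (hS : S.Nonempty) :
    ∃ v ∈ S, ((S.filter (D v)).card : ℝ) < (3 - √7) * S.card := by
  classical
  have h7 : √7 ^ 2 = 7 := Real.sq_sqrt (by norm_num)
  have h70 : 0 ≤ √7 := Real.sqrt_nonneg 7
  have h73 : √7 < 3 := by nlinarith
  induction hm : S.card using Nat.strong_induction_on generalizing D S with
  | _ m ih =>
    subst hm
    set α := 3 - √7 with hα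
    have hα0 : 0 < α := by rw [hα]; linarith
    have hα2 : α * (6 - α) = 2 := by rw [hα]; nlinarith
    by_contra! hcon
    set r := ⌈α * S.card⌉₊ with hrdef
    have hn0 : (0 : ℝ) < S.card := by exact_mod_cast hS.card_pos
    have hr0 : 0 < r := Nat.ceil_pos.2 (mul_pos hα0 hn0)
    have hex : ∀ u, ∃ N : Finset V, N ⊆ S.filter (D u) ∧ (u ∈ S → N.card = r) := by
      intro u
      by_cases hu : u ∈ S
      · obtain ⟨N, h1, h2⟩ := Finset.exists_subset_card_eq (Nat.ceil_le.2 (hcon u hu))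
        exact ⟨N, h1, fun _ => h2⟩
      · exact ⟨∅, by simp, fun h => absurd h hu⟩
    choose N hN hNr using hex
    have hND : ∀ u v, v ∈ N u → D u v := fun u v h => (Finset.mem_filter.1 (hN u h)).2
    have hNS : ∀ u ∈ S, N u ⊆ S := fun u _ => (hN u).trans (Finset.filter_subset _ _)
    have has : ∀ u ∈ S, ∀ v ∈ N u, u ∉ N v := fun u _ v hv h =>
      hasymm u v (hND u v hv) (hND v u h)
    have hmain := shen_global_inequality hα0.le hr0 hS hNS (fun u hu => hNr u hu) has
      fun u hu v hv => shen_edge_inequality (α := α) hNS (fun u hu => hNr u hu) has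
        (fun u _ v hv w hw h => htri u v w (hND u v hv) (hND v w hw) (hND w u h))
        (fun M hM hne hMne => by
          obtain ⟨w, hw, hlt⟩ := ih M.card (Finset.card_lt_card (lt_of_le_of_ne hM hne))
            (fun u v => v ∈ N u) (fun u v h h' => hasymm u v (hND u v h) (hND v u h'))
            (fun u v w h h' h'' => htri u v w (hND u v h) (hND v w h') (hND w u h'')) M hMne rfl
          rw [Finset.filter_mem_eq_inter] at hlt
          exact ⟨w, hw, hlt⟩) hu hv
    have hr1 : α * S.card ≤ r := Nat.le_ceil _
    have hα1 : α < 6 := by rw [hα]; linarith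
    nlinarith [mul_le_mul_of_nonneg_left hr1 (by linarith : (0 : ℝ) ≤ 3 - α / 2)]

end Shen

/-! ### The unconditional results -/

lemma mem_monoReach_of_adj {V : Type*} {k : ℕ} {T : Digraph V} {c : V → V → Fin k} {L : ℕ∞}
    (hL : 1 ≤ L) {u v : V} (h : T.Adj v u) : u ∈ monoReach T c L v :=
  ⟨c v u, 1, by exact_mod_cast hL, Or.inr ⟨v, rfl, h, rfl⟩⟩

/-- The vertices not reached by walks with at most two edges form the out-neighbourhoods of a
digraph to which Shen's theorem applies: two of the three edges of a triangle have the same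
colour. -/
lemma ReachBound.shen {n m : ℕ} (hn : 0 < n) (h : ReachBound 2 2 n m) : (√7 - 2) * n ≤ m := by
  classical
  obtain ⟨T, hT, c, hc⟩ := h
  let D : Fin n → Fin n → Prop := fun v u => u ∉ monoReach T c 2 v
  have hrev : ∀ u v, D u v → T.Adj v u := by
    intro u v h
    by_cases huv : u = v
    · subst huv
      exact absurd ⟨0, 0, by simp, rfl⟩ h
    · rcases hT.adj_xor u v huv with h' | h'
      · exact absurd (mem_monoReach_of_adj (by norm_num) h'.1) h
      · exact h'.1
  have hasymm : ∀ u v, D u v → ¬ D v u := by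
    intro u v h h'
    have hne : u ≠ v := by rintro rfl; exact hT.loopless _ (hrev _ _ h)
    rcases hT.adj_xor u v hne with h1 | h1
    · exact h1.2 (hrev _ _ h)
    · exact h1.2 (hrev _ _ h')
  have htwo : ∀ u v w, D u v → D v w → D w u → c v u ≠ c u w := by
    intro u v w h1 h2 h3 hcol
    exact h2 ⟨c v u, 2, le_rfl,
      Or.inr ⟨u, Or.inr ⟨v, rfl, hrev _ _ h1, rfl⟩, hrev _ _ h3, hcol.symm⟩⟩
  have htri : ∀ u v w, D u v → D v w → ¬ D w u := by
    intro u v w h1 h2 h3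
    have a1 := htwo u v w h1 h2 h3
    have a2 := htwo v w u h2 h3 h1
    have a3 := htwo w u v h3 h1 h2
    omega
  obtain ⟨v, -, hv⟩ := exists_outdegree_lt D hasymm htri Finset.univ ⟨⟨0, hn⟩, Finset.mem_univ _⟩
  have h1 := Finset.card_filter_add_card_filter_not (s := (Finset.univ : Finset (Fin n))) (D v)
  have h2 : (Finset.univ.filter fun u => ¬ D v u).card ≤ m := by
    refine le_trans ?_ (hc v)
    rw [← Set.ncard_coe_finset]
    exact Set.ncard_le_ncard fun u hu => not_not.1 (Finset.mem_filter.1 hu).2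
  rw [Finset.card_univ, Fintype.card_fin] at h1
  rw [Finset.card_univ, Fintype.card_fin] at hv
  have h1' : ((Finset.univ.filter (D v)).card : ℝ) +
      (Finset.univ.filter fun u => ¬ D v u).card = n := by
    exact_mod_cast h1
  have h2' : ((Finset.univ.filter fun u => ¬ D v u).card : ℝ) ≤ m := by exact_mod_cast h2
  linarith

lemma cyclic_density_lt {ℓ r : ℕ} (hr : 0 < r) :
    (((ℓ * r + 1 : ℕ) : ℝ)) / (((ℓ + 1) * r + 1 : ℕ) : ℝ) < (ℓ : ℝ) / (ℓ + 1) + 1 / r := by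
  have hr' : (0 : ℝ) < r := by exact_mod_cast hr
  have hl : (0 : ℝ) ≤ ℓ := Nat.cast_nonneg ℓ
  push_cast
  rw [div_add_div _ _ (by positivity) (by positivity),
    div_lt_div_iff₀ (by positivity) (by positivity)]
  nlinarith [mul_nonneg hl hr'.le, mul_pos hr' hr', mul_nonneg hl hl,
    mul_nonneg (mul_nonneg hl hl) hr'.le]

lemma exists_reachBound_cyclic {ℓ : ℕ} (hℓ : 1 ≤ ℓ) {ε : ℝ} (hε : 0 < ε) :
    ∃ n m : ℕ, 0 < n ∧ ReachBound 2 ℓ n m ∧ (m : ℝ) / n < (ℓ : ℝ) / (ℓ + 1) + ε := by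
  obtain ⟨r, hr⟩ := exists_nat_one_div_lt hε
  refine ⟨_, _, Nat.succ_pos _, reachBound_cyclic hℓ (r + 1), ?_⟩
  have := cyclic_density_lt (ℓ := ℓ) (Nat.succ_pos r)
  push_cast at this hr ⊢
  linarith

lemma exists_reachBound_three_pow {k : ℕ} (hk : 3 ≤ k) {ε : ℝ} (hε : 0 < ε) :
    ∃ n m : ℕ, 0 < n ∧ ReachBound k ⊤ n m ∧ (m : ℝ) / n < 1 / 2 + ε := by
  obtain ⟨t, ht⟩ := exists_pow_lt_of_lt_one hε (by norm_num : (1 / 3 : ℝ) < 1)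
  obtain ⟨m, hm, hb⟩ := reachBound_three_pow hk t
  refine ⟨3 ^ t, m, by positivity, hb, ?_⟩
  have h3 : (0 : ℝ) < 3 ^ t := by positivity
  have hm' : 2 * (m : ℝ) = 3 ^ t + 1 := by exact_mod_cast hm
  have : (m : ℝ) / 3 ^ t = 1 / 2 + (1 / 3) ^ t / 2 := by
    rw [div_pow, one_pow]
    field_simp
    linarith
  push_cast
  rw [this]
  have : (0 : ℝ) < (1 / 3) ^ t := by positivity
  linarith

/-- Three colours: the lower bound is given by a star, the upper bound by iterated cyclic
triangles. -/
theorem fLimit_three {k : ℕ} (hk : 3 ≤ k) : FLimit k (1 / 2) := by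
  refine tendsto_of_reachBound (L := ⊤) (by omega) (fun n m h => h.fMin_le) (fun ε hε => ?_)
    fun ε hε => exists_reachBound_three_pow hk hε
  filter_upwards [eventually_gt_atTop 0] with n hn
  have h : (n + 1) / 2 ≤ fMin k n := le_fMin (by omega) fun T hT c => by
    obtain ⟨r, t, -, ht⟩ := hT.exists_half hn c
    exact ⟨r, t, by omega⟩
  have h' : (n : ℝ) ≤ 2 * fMin k n := by exact_mod_cast (by omega : n ≤ 2 * fMin k n)
  have hn' : (0 : ℝ) < n := by exact_mod_cast hn
  have : 1 / 2 ≤ (fMin k n : ℝ) / n := by rw [le_div_iff₀ hn']; linarith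
  linarith

theorem fDepthLimit_three {k ℓ : ℕ} (hk : 3 ≤ k) (hℓ : 1 ≤ ℓ) : FDepthLimit k ℓ (1 / 2) := by
  refine tendsto_of_reachBound (L := ⊤) (by omega) (fun n m h => (h.mono le_top).fDepth_le)
    (fun ε hε => ?_) fun ε hε => exists_reachBound_three_pow hk hε
  filter_upwards [eventually_gt_atTop 0] with n hn
  have h : (n + 1) / 2 ≤ fDepth k ℓ n := le_fDepth (by omega) fun T hT c => by
    obtain ⟨r, t, hd, ht⟩ := hT.exists_half hn c
    exact ⟨r, t, fun v hv => (hd v hv).trans hℓ, by omega⟩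
  have h' : (n : ℝ) ≤ 2 * fDepth k ℓ n := by exact_mod_cast (by omega : n ≤ 2 * fDepth k ℓ n)
  have hn' : (0 : ℝ) < n := by exact_mod_cast hn
  have : 1 / 2 ≤ (fDepth k ℓ n : ℝ) / n := by rw [le_div_iff₀ hn']; linarith
  linarith

/-- For depth two the limit is the infimum of the densities. -/
theorem exists_fDepthLimit_two :
    ∃ x : ℝ, FDepthLimit 2 2 x ∧ x ∈ Set.Icc (√7 - 2) (2 / 3) := by
  set R : Set ℝ := Set.range fun n : ℕ => (fDepth 2 2 (n + 1) : ℝ) / ((n + 1 : ℕ) : ℝ) with hR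
  have hbdd : BddBelow R := ⟨0, by rintro _ ⟨n, rfl⟩; positivity⟩
  have hne : R.Nonempty := Set.range_nonempty _
  refine ⟨sInf R, ?_, le_csInf hne ?_, le_of_forall_pos_lt_add fun ε hε => ?_⟩
  · refine tendsto_of_reachBound (L := (2 : ℕ)) two_pos (fun n m h => h.fDepth_le)
      (fun ε hε => ?_) fun ε hε => ?_
    · filter_upwards [eventually_gt_atTop 0] with n hn
      have : sInf R ≤ (fDepth 2 2 n : ℝ) / n :=
        csInf_le hbdd ⟨n - 1, by dsimp only; rw [Nat.sub_add_cancel hn]⟩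
      linarith
    · obtain ⟨_, ⟨n, rfl⟩, hn⟩ := exists_lt_of_csInf_lt hne (lt_add_of_pos_right (sInf R) hε)
      exact ⟨n + 1, _, Nat.succ_pos n, reachBound_of_fDepth_two_le two_pos le_rfl, hn⟩
  · rintro _ ⟨n, rfl⟩
    rw [le_div_iff₀ (by positivity)]
    exact (reachBound_of_fDepth_two_le two_pos le_rfl).shen (Nat.succ_pos n)
  · obtain ⟨n, m, hn, hb, hlt⟩ := exists_reachBound_cyclic (ℓ := 2) one_le_two hε
    have h1 : sInf R ≤ (fDepth 2 2 n : ℝ) / n :=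
      csInf_le hbdd ⟨n - 1, by dsimp only; rw [Nat.sub_add_cancel hn]⟩
    have h2 : (fDepth 2 2 n : ℝ) / n ≤ (m : ℝ) / n :=
      div_le_div_of_nonneg_right (by exact_mod_cast hb.fDepth_le) (Nat.cast_nonneg n)
    push_cast at hlt
    norm_num at hlt ⊢
    linarith

/-! ### The theorem of Sands, Sauer and Woodrow for tournaments -/

section SandsSauerWoodrow

variable {V : Type*} {T : Digraph V}

/-- In each set `U` of vertices of a tournament whose edges have two colours, some vertex reaches
all of `U` by monochromatic walks inside `U`. Otherwise let `f u` reach all of `U` except `u`.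
There are then edges from `u` to `f u`, and not all edges `(u, f u)`, `(f u, f (f u))` can
have the same colour, because `f` has a periodic point. If they have different colours, then a
walk from `f (f u)` to `u` can be extended at one of its ends. -/
theorem exists_dominating_of_two_colours (hT : IsTournament T) (c : V → V → Fin 2)
    (U : Finset V) (hU : U.Nonempty) : ∃ v ∈ U, ∀ u ∈ U, ∃ a,
      Relation.ReflTransGen (fun x y => x ∈ U ∧ y ∈ U ∧ T.Adj x y ∧ c x y = a) v u := by
  classical
  induction hm : U.card using Nat.strong_induction_on generalizing U with
  | _ m ih =>
    subst hm
    by_contra! hcon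
    have hex : ∀ u : U, ∃ w : U, w ≠ u ∧ ∀ x ∈ U, x ≠ u → ∃ a,
        Relation.ReflTransGen (fun x y => x ∈ U ∧ y ∈ U ∧ T.Adj x y ∧ c x y = a) w x := by
      rintro ⟨u, hu⟩
      have hne : (U.erase u).Nonempty := by
        rw [Finset.nonempty_iff_ne_empty]
        intro h
        obtain ⟨x, hx, hx'⟩ := hcon u hu
        by_cases hxu : x = u
        · subst hxu
          exact hx' 0 Relation.ReflTransGen.refl
        · have : x ∈ U.erase u := Finset.mem_erase.2 ⟨hxu, hx⟩
          rw [h] at this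
          simp at this
      obtain ⟨w, hw, hreach⟩ := ih _ (Finset.card_erase_lt_of_mem hu) (U.erase u) hne rfl
      refine ⟨⟨w, (Finset.mem_erase.1 hw).2⟩,
        fun h => (Finset.mem_erase.1 hw).1 (congrArg Subtype.val h), fun x hx hxu => ?_⟩
      obtain ⟨a, ha⟩ := hreach x (Finset.mem_erase.2 ⟨hxu, hx⟩)
      exact ⟨a, Relation.ReflTransGen.mono (fun y z h =>
        ⟨(Finset.mem_erase.1 h.1).2, (Finset.mem_erase.1 h.2.1).2, h.2.2⟩) _ _ ha⟩
    choose f hfne hf using hex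
    have hnot : ∀ u : U, ∀ a, ¬ Relation.ReflTransGen
        (fun x y => x ∈ U ∧ y ∈ U ∧ T.Adj x y ∧ c x y = a) (f u : V) (u : V) := by
      intro u a ha
      obtain ⟨x, hx, hx'⟩ := hcon (f u) (f u).2
      by_cases hxu : x = u
      · subst hxu
        exact hx' a ha
      · obtain ⟨b, hb⟩ := hf u x hx hxu
        exact hx' b hb
    have hadj : ∀ u : U, T.Adj u (f u) := by
      intro u
      rcases hT.adj_xor (u : V) (f u) (fun h => hfne u (Subtype.ext h.symm)) with h | h
      · exact h.1
      · exact absurd (Relation.ReflTransGen.single ⟨(f u).2, u.2, h.1, rfl⟩) (hnot u _)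
    have hcol : ∀ u : U, c (f u) (f (f u)) = c u (f u) := by
      intro u
      by_contra hne
      obtain ⟨a, ha⟩ := hf (f u) u u.2 (fun h => hfne u (Subtype.ext h.symm))
      have : a = c u (f u) ∨ a = c (f u) (f (f u)) := by omega
      rcases this with rfl | rfl
      · exact hnot (f u) _ (ha.tail ⟨u.2, (f u).2, hadj u, rfl⟩)
      · exact hnot u _ (ha.head ⟨(f u).2, (f (f u)).2, hadj (f u), rfl⟩)
    have hcol' : ∀ (u : U) (i : ℕ), c (f^[i] u) (f (f^[i] u)) = c u (f u) := by
      intro u i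
      induction i with
      | zero => rfl
      | succ i ihi => rw [Function.iterate_succ_apply', hcol, ihi]
    obtain ⟨u0, hu0⟩ := hU
    obtain ⟨i, j, hij, heq⟩ : ∃ i j, i < j ∧ f^[i] (⟨u0, hu0⟩ : U) = f^[j] ⟨u0, hu0⟩ := by
      obtain ⟨i, j, hne, heq⟩ :=
        Finite.exists_ne_map_eq_of_infinite fun i : ℕ => f^[i] (⟨u0, hu0⟩ : U)
      rcases lt_or_gt_of_ne hne with h | h
      · exact ⟨i, j, h, heq⟩
      · exact ⟨j, i, h, heq.symm⟩
    set u := f^[i] (⟨u0, hu0⟩ : U) with hu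
    obtain ⟨d, rfl⟩ : ∃ d, j = d + 1 + i := ⟨j - i - 1, by omega⟩
    rw [Function.iterate_add_apply, ← hu] at heq
    have hwalk : ∀ d : ℕ, Relation.ReflTransGen
        (fun x y => x ∈ U ∧ y ∈ U ∧ T.Adj x y ∧ c x y = c u (f u)) (f u : V) (f^[d + 1] u : U) := by
      intro d
      induction d with
      | zero => exact Relation.ReflTransGen.refl
      | succ d ihd =>
        refine ihd.tail ⟨Subtype.coe_prop _, Subtype.coe_prop _, ?_, ?_⟩
        · rw [Function.iterate_succ_apply' f (d + 1)]
          exact hadj _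
        · rw [Function.iterate_succ_apply' f (d + 1)]
          exact hcol' u (d + 1)
    have := hwalk d
    rw [← heq] at this
    exact hnot u _ this

lemma exists_monoWalk_dominating [Fintype V] [Nonempty V] (hT : IsTournament T)
    (c : V → V → Fin 2) : ∃ v, ∀ u, ∃ a j, MonoWalk T c a j v u := by
  obtain ⟨v, -, hv⟩ := exists_dominating_of_two_colours hT c Finset.univ Finset.univ_nonempty
  refine ⟨v, fun u => ?_⟩
  obtain ⟨a, ha⟩ := hv u (Finset.mem_univ u)
  refine ⟨a, ?_⟩
  induction ha with
  | refl => exact ⟨0, rfl⟩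
  | tail _ h ih =>
    obtain ⟨j, hj⟩ := ih
    exact ⟨j + 1, Or.inr ⟨_, hj, h.2.2⟩⟩

end SandsSauerWoodrow

section Shortest

variable {V : Type*} {k : ℕ} {T : Digraph V} {c : V → V → Fin k} {a : Fin k}

lemma MonoWalk.exists_penultimate {j : ℕ} {v u : V} (h : MonoWalk T c a (j + 1) v u)
    (hmin : ∀ i < j + 1, ¬ MonoWalk T c a i v u) :
    ∃ w, MonoWalk T c a j v w ∧ (∀ i < j, ¬ MonoWalk T c a i v w) ∧ T.Adj w u ∧ c w u = a := by
  rcases h with h | ⟨w, hw, hadj, hc⟩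
  · exact absurd h (hmin j (Nat.lt_succ_self j))
  · exact ⟨w, hw, fun i hi hwi => hmin (i + 1) (by omega) (Or.inr ⟨w, hwi, hadj, hc⟩), hadj, hc⟩

/-- A shortest walk with `j` edges has `j + 1` distinct vertices. -/
lemma MonoWalk.lt_card [Fintype V] {j : ℕ} {v u : V} (h : MonoWalk T c a j v u)
    (hmin : ∀ i < j, ¬ MonoWalk T c a i v u) : j < Fintype.card V := by
  classical
  have key : ∀ (j : ℕ) (u : V), MonoWalk T c a j v u → (∀ i < j, ¬ MonoWalk T c a i v u) →
      j < (Finset.univ.filter fun w => MonoWalk T c a j v w).card := by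
    intro j
    induction j with
    | zero => intro u hu _; exact Finset.card_pos.2 ⟨u, by simpa using hu⟩
    | succ j ih =>
      intro u hu hmin
      obtain ⟨w, hw, hwmin, -⟩ := hu.exists_penultimate hmin
      refine lt_of_le_of_lt (ih w hw hwmin) (Finset.card_lt_card ?_)
      have hsub : (Finset.univ.filter fun w => MonoWalk T c a j v w) ⊆
          Finset.univ.filter fun w => MonoWalk T c a (j + 1) v w :=
        Finset.monotone_filter_right _ fun x _ hx => Or.inl hx
      rw [Finset.ssubset_iff_of_subset hsub]
      exact ⟨u, by simpa using hu, by simpa using hmin j (Nat.lt_succ_self j)⟩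
  exact (key j u h hmin).trans_le (Finset.card_le_univ _)

/-- Induction along a shortest walk. It does not return to its first vertex `v`. -/
lemma MonoWalk.shortest_induction {J : ℕ} {v : V} (P : ℕ → V → Prop)
    (h1 : ∀ w, T.Adj v w → c v w = a → P 1 w)
    (h2 : ∀ j w u, j < J → w ≠ v → u ≠ v → P j w → T.Adj w u → c w u = a → P (j + 1) u)
    {u : V} (huv : u ≠ v) (h : MonoWalk T c a J v u) (hmin : ∀ i < J, ¬ MonoWalk T c a i v u) :
    P J u := by
  have key : ∀ j ≤ J, ∀ u, u ≠ v → MonoWalk T c a j v u → (∀ i < j, ¬ MonoWalk T c a i v u) →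
      P j u := by
    intro j
    induction j with
    | zero => intro _ u hne hu _; exact absurd hu hne
    | succ j ih =>
      intro hj u hne hu hmin
      obtain ⟨w, hw, hwmin, hadj, hc⟩ := hu.exists_penultimate hmin
      by_cases hwv : w = v
      · subst hwv
        have hj0 : j = 0 := by
          by_contra h0
          exact hwmin 0 (Nat.pos_of_ne_zero h0) rfl
        subst hj0
        exact h1 u hadj hc
      · exact h2 j w u hj hwv hne (ih (by omega) w hwv hw hwmin) hadj hc
  exact key J le_rfl u huv h hmin

end Shortest

/-! ### Robust walks -/

section Robust

variable {V : Type*} {k : ℕ}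

/-- The vertex `u` is robustly reached from `v` by walks of colour `a` with at most `j` edges: it is
joined to `v` by an edge of colour `a`, or there are at least `s` candidates for the last but one
vertex of such a walk. -/
def RobustWalk (T : Digraph V) (c : V → V → Fin k) (s : ℕ) (a : Fin k) : ℕ → V → V → Prop
  | 0, _, _ => False
  | j + 1, v, u => (T.Adj v u ∧ c v u = a) ∨
      s ≤ {w | RobustWalk T c s a j v w ∧ T.Adj w u ∧ c w u = a}.ncard

variable {T : Digraph V} {c : V → V → Fin k} {s : ℕ} {a : Fin k}

lemma RobustWalk.succ [Finite V] {j : ℕ} {v u : V} (h : RobustWalk T c s a j v u) :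
    RobustWalk T c s a (j + 1) v u := by
  induction j generalizing u with
  | zero => exact h.elim
  | succ j ih =>
    rcases h with h | h
    · exact Or.inl h
    · exact Or.inr (h.trans (Set.ncard_le_ncard fun w hw => ⟨ih hw.1, hw.2⟩))

lemma RobustWalk.mono [Finite V] {i j : ℕ} (hij : i ≤ j) {v u : V} (h : RobustWalk T c s a i v u) :
    RobustWalk T c s a j v u := by
  induction j, hij using Nat.le_induction with
  | base => exact h
  | succ j _ ih => exact ih.succ

/-- An edge `(w, u)` that extends a robust walk from `v` to `w`, but not to a robust walk. -/
def IsDefect (T : Digraph V) (c : V → V → Fin k) (s ℓ : ℕ) (v w u : V) : Prop :=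
  ∃ a, ∃ j : Fin ℓ, RobustWalk T c s a j v w ∧ T.Adj w u ∧ c w u = a ∧
    ¬ RobustWalk T c s a (j + 1) v u

lemma ncard_isDefect_le [Finite V] (T : Digraph V) (c : V → V → Fin k) (s ℓ : ℕ) (v u : V) :
    {w | IsDefect T c s ℓ v w u}.ncard ≤ k * ℓ * s := by
  classical
  have := Fintype.ofFinite V
  have hsub : {w | IsDefect T c s ℓ v w u} ⊆ ((Finset.univ : Finset (Fin k × Fin ℓ)).biUnion
      fun p => Finset.univ.filter fun w => RobustWalk T c s p.1 p.2 v w ∧ T.Adj w u ∧ c w u = p.1 ∧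
        ¬ RobustWalk T c s p.1 (p.2 + 1) v u : Finset V) := by
    rintro w ⟨a, j, hw⟩
    simp only [Finset.coe_biUnion, Set.mem_iUnion]
    exact ⟨(a, j), by simp, by simpa using hw⟩
  refine (Set.ncard_le_ncard hsub).trans ?_
  rw [Set.ncard_coe_finset]
  refine (Finset.card_biUnion_le_card_mul _ _ s fun p _ => ?_).trans (by simp)
  by_cases h : RobustWalk T c s p.1 (p.2 + 1) v u
  · simp [h]
  · have h' : ¬ s ≤ {w | RobustWalk T c s p.1 p.2 v w ∧ T.Adj w u ∧ c w u = p.1}.ncard :=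
      fun h'' => h (Or.inr h'')
    refine le_trans ?_ (not_le.1 h').le
    rw [← Set.ncard_coe_finset]
    refine Set.ncard_le_ncard fun w hw => ?_
    have := (Finset.mem_filter.1 hw).2
    exact ⟨this.1, this.2.1, this.2.2.1⟩

/-- The vertex `u` is not robustly reached from `v`. -/
def NotRobust (T : Digraph V) (c : V → V → Fin k) (s ℓ : ℕ) (v u : V) : Prop :=
  u ≠ v ∧ ∀ a, ¬ RobustWalk T c s a ℓ v u

/-- For a family of vertices without defects, the digraph of the pairs that are not robustly
connected has no directed cycle with at most `ℓ + 1` vertices, by the theorem of Sands, Sauer and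
Woodrow. Hence the Caccetta-Häggkvist conjecture gives a vertex of small out-degree. -/
lemma CaccettaHaggkvist.exists_outdegree_lt [Finite V] (hCH : CaccettaHaggkvist)
    {T : Digraph V} (hT : IsTournament T) (c : V → V → Fin 2) (s ℓ : ℕ) {r : ℕ} (hr : 0 < r)
    (x : Fin ((ℓ + 1) * r) → V) (hx : Function.Injective x)
    (hdef : ∀ i j k, i ≠ j → i ≠ k → j ≠ k → ¬ IsDefect T c s ℓ (x i) (x j) (x k)) :
    ∃ i, {j | NotRobust T c s ℓ (x i) (x j)}.ncard < r := by
  by_contra! hcon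
  obtain ⟨m, hm, hm0, y, hy, hcyc⟩ := hCH ((ℓ + 1) * r) r (by positivity) hr
    ⟨fun i j => NotRobust T c s ℓ (x i) (x j)⟩ (fun i h => h.1 rfl) hcon
  have hml : m ≤ ℓ + 1 := by
    refine hm.trans (Nat.ceil_le.2 ?_)
    push_cast
    rw [mul_div_assoc, div_self (by positivity), mul_one]
  have : NeZero m := ⟨hm0.ne'⟩
  have hz : Function.Injective fun i => x (y i) := hx.comp hy
  obtain ⟨i, hi⟩ := exists_monoWalk_dominating (V := ZMod m)
    (T := ⟨fun i j => T.Adj (x (y i)) (x (y j))⟩)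
    ⟨fun v => hT.loopless _, fun u v h => hT.adj_xor _ _ (hz.ne h)⟩
    (fun i j => c (x (y i)) (x (y j)))
  obtain ⟨a, hj⟩ := hi (i + 1)
  classical
  have hne : i + 1 ≠ i := fun h => (hcyc i).1 (by rw [h])
  have hmin := fun i => Nat.find_min hj (m := i)
  have hwalk := Nat.find_spec hj
  have hlt := hwalk.lt_card hmin
  rw [ZMod.card] at hlt
  refine (hcyc i).2 a (RobustWalk.mono (i := Nat.find hj) (by omega) ?_)
  refine MonoWalk.shortest_induction (fun j w => RobustWalk T c s a j (x (y i)) (x (y w)))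
    (fun w h h' => Or.inl ⟨h, h'⟩) ?_ hne hwalk hmin
  intro j w u hj hw hu hrob hadj hc
  by_contra hnot
  have hwu : w ≠ u := by rintro rfl; exact hT.loopless _ hadj
  exact hdef (y i) (y w) (y u) (hy.ne hw.symm) (hy.ne hu.symm) (hy.ne hwu)
    ⟨a, ⟨j, by omega⟩, hrob, hadj, hc, hnot⟩

end Robust

/-! ### Random samples of vertices -/

section Sampling

variable {V : Type*} [Fintype V] {M : ℕ}

/-- If, for any values of the other coordinates, at most `b` values of the `i`-th coordinate make
`P` true, then at most a proportion `b / |V|` of all samples satisfies `P`. -/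
lemma card_sample_le (P : (Fin M → V) → Prop) (i : Fin M) (b : ℕ)
    (hb : ∀ x : Fin M → V, {w | P (Function.update x i w)}.ncard ≤ b) :
    Fintype.card V * {x | P x}.ncard ≤ b * Fintype.card V ^ M := by
  classical
  let A : Finset ((Fin M → V) × V) := Finset.univ.filter fun p => P p.1
  let B : Finset ((Fin M → V) × V) := Finset.univ.filter fun p => P (Function.update p.1 i p.2)
  have hA : A.card = Fintype.card V * {x | P x}.ncard := by
    have : A = (Finset.univ.filter P) ×ˢ Finset.univ := by ext; simp [A]
    rw [this, Finset.card_product, mul_comm, Finset.card_univ, ← Set.ncard_coe_finset]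
    simp
  have hB : B.card ≤ b * Fintype.card V ^ M := by
    have : B.card = ∑ x : Fin M → V, {w | P (Function.update x i w)}.ncard := by
      simp only [B]
      rw [Finset.card_filter, Fintype.sum_prod_type]
      refine Finset.sum_congr rfl fun x _ => ?_
      rw [← Finset.card_filter, ← Set.ncard_coe_finset]
      simp
    rw [this]
    refine (Finset.sum_le_card_nsmul _ _ b fun x _ => hb x).trans ?_
    simp [mul_comm]
  rw [← hA]
  refine le_trans (Finset.card_le_card_of_injOn
    (fun p => (Function.update p.1 i p.2, p.1 i)) ?_ ?_) hB
  · rintro ⟨x, v⟩ hx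
    have hx : P x := by simpa [A] using hx
    simpa [B] using hx
  · rintro ⟨x, v⟩ - ⟨y, w⟩ - h
    simp only [Prod.mk.injEq] at h
    have h1 : v = w := by simpa using congrFun h.1 i
    refine Prod.ext (funext fun j => ?_) h1
    by_cases hj : j = i
    · rw [hj]; exact h.2
    · simpa [hj] using congrFun h.1 j

/-- The exponential moment of the number of out-neighbours of the `i`-th sample point among all
sample points. -/
lemma sum_pow_ncard_le (D : V → V → Prop) {η q : ℝ} (hη : 0 < η) (hη1 : η < 1)
    (hD : ∀ v, q * Fintype.card V ≤ {u | D v u}.ncard) (i : Fin M) :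
    ∑ x : Fin M → V, (1 - η) ^ {j | D (x i) (x j)}.ncard ≤
      Fintype.card V * (Fintype.card V * (1 - η * q)) ^ (M - 1) := by
  classical
  let g : V → V → ℝ := fun v u => if D v u then 1 - η else 1
  have hg0 : ∀ v u, 0 ≤ g v u := fun v u => by simp only [g]; split_ifs <;> linarith
  have hg1 : ∀ v u, g v u ≤ 1 := fun v u => by simp only [g]; split_ifs <;> linarith
  have hpow : ∀ x : Fin M → V, (1 - η) ^ {j | D (x i) (x j)}.ncard = ∏ j, g (x i) (x j) := by
    intro x
    simp only [g]
    rw [Finset.prod_ite, Finset.prod_const_one, mul_one, Finset.prod_const, ← Set.ncard_coe_finset]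
    simp
  have hsum : ∀ v, ∑ u, g v u ≤ Fintype.card V * (1 - η * q) := by
    intro v
    have h1 : ∑ u, g v u = ∑ u, (1 - η * if D v u then 1 else 0) :=
      Finset.sum_congr rfl fun u _ => by simp only [g]; split_ifs <;> ring
    have h2 : ((Finset.univ.filter fun u => D v u).card : ℝ) = {u | D v u}.ncard := by
      rw [← Set.ncard_coe_finset]; simp
    rw [h1, Finset.sum_sub_distrib, ← Finset.mul_sum, Finset.sum_boole, h2]
    have := mul_le_mul_of_nonneg_left (hD v) hη.le
    simp only [Finset.sum_const, Finset.card_univ, nsmul_eq_mul, mul_one]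
    linarith
  have hfib : ∀ v, ∑ x : Fin M → V with x i = v, (1 - η) ^ {j | D (x i) (x j)}.ncard ≤
      (Fintype.card V * (1 - η * q)) ^ (M - 1) := by
    intro v
    have hset : (Finset.univ.filter fun x : Fin M → V => x i = v) =
        Fintype.piFinset fun j => if j = i then {v} else Finset.univ := by
      ext x
      simp only [Finset.mem_filter, Finset.mem_univ, true_and, Fintype.mem_piFinset]
      constructor
      · intro h j
        by_cases hj : j = i
        · simp [hj, h]
        · simp [hj]
      · intro h
        simpa using h i
    calc ∑ x : Fin M → V with x i = v, (1 - η) ^ {j | D (x i) (x j)}.ncard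
        = ∑ x : Fin M → V with x i = v, ∏ j, g v (x j) := by
          refine Finset.sum_congr rfl fun x hx => ?_
          rw [hpow, (Finset.mem_filter.1 hx).2]
      _ = ∏ j : Fin M, ∑ u ∈ (if j = i then {v} else Finset.univ : Finset V), g v u := by
          rw [hset, Finset.prod_univ_sum]
      _ = g v v * ∏ j ∈ Finset.univ.erase i, ∑ u, g v u := by
          rw [← Finset.mul_prod_erase _ _ (Finset.mem_univ i)]
          congr 1
          · simp
          · refine Finset.prod_congr rfl fun j hj => ?_
            rw [if_neg (Finset.mem_erase.1 hj).1]
      _ ≤ 1 * ∏ j ∈ Finset.univ.erase i, ∑ u, g v u :=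
          mul_le_mul_of_nonneg_right (hg1 v v)
            (Finset.prod_nonneg fun j _ => Finset.sum_nonneg fun u _ => hg0 v u)
      _ = (∑ u, g v u) ^ (M - 1) := by
          rw [one_mul, Finset.prod_const, Finset.card_erase_of_mem (Finset.mem_univ i),
            Finset.card_univ, Fintype.card_fin]
      _ ≤ _ := pow_le_pow_left₀ (Finset.sum_nonneg fun u _ => hg0 v u) (hsum v) _
  rw [← Finset.sum_fiberwise Finset.univ (fun x : Fin M → V => x i)]
  refine (Finset.sum_le_sum fun v _ => hfib v).trans ?_
  simp

/-- A random sample of `M` vertices is injective, avoids all defects, and has minimum out-degree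
at least `r`, as soon as the expected number of violations is less than one. -/
lemma exists_sample [Nonempty V] (B : V → V → V → Prop) (D : V → V → Prop) {η q : ℝ} {b r : ℕ}
    (hη : 0 < η) (hη1 : η < 1)
    (hB : ∀ v u, {w | B v w u}.ncard ≤ b) (hD : ∀ v, q * Fintype.card V ≤ {u | D v u}.ncard)
    (hlt : (M : ℝ) ^ 2 / Fintype.card V + M ^ 3 * b / Fintype.card V +
      M * (1 - η * q) ^ (M - 1) / (1 - η) ^ r < 1) :
    ∃ x : Fin M → V, Function.Injective x ∧
      (∀ i j k, i ≠ j → i ≠ k → j ≠ k → ¬ B (x i) (x j) (x k)) ∧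
      ∀ i, r ≤ {j | D (x i) (x j)}.ncard := by
  classical
  set n := Fintype.card V with hn
  have hn0 : 0 < n := Fintype.card_pos
  have hn0' : (0 : ℝ) < n := by exact_mod_cast hn0
  have hη' : 0 < 1 - η := by linarith
  let B1 : Finset (Fin M → V) := (Finset.univ : Finset (Fin M × Fin M)).biUnion fun p =>
    Finset.univ.filter fun x => p.1 ≠ p.2 ∧ x p.1 = x p.2
  let B2 : Finset (Fin M → V) := (Finset.univ : Finset (Fin M × Fin M × Fin M)).biUnion fun p =>
    Finset.univ.filter fun x => (p.1 ≠ p.2.1 ∧ p.2.2 ≠ p.2.1) ∧ B (x p.1) (x p.2.1) (x p.2.2)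
  let B3 : Finset (Fin M → V) := (Finset.univ : Finset (Fin M)).biUnion fun i =>
    Finset.univ.filter fun x => {j | D (x i) (x j)}.ncard < r
  have h1 : (B1.card : ℝ) ≤ M ^ 2 * (n ^ M / n) := by
    have : ∀ p ∈ (Finset.univ : Finset (Fin M × Fin M)), ((Finset.univ.filter
        fun x : Fin M → V => p.1 ≠ p.2 ∧ x p.1 = x p.2).card : ℝ) ≤ n ^ M / n := by
      intro p _
      rw [le_div_iff₀ hn0', mul_comm]
      have := card_sample_le (fun x : Fin M → V => p.1 ≠ p.2 ∧ x p.1 = x p.2) p.1 1 (by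
        intro x
        by_cases hp : p.1 = p.2
        · simp [hp]
        · refine (Set.ncard_le_ncard (t := {x p.2}) ?_).trans (by simp)
          rintro w ⟨-, hw⟩
          simpa [Function.update_of_ne (Ne.symm hp)] using hw)
      rw [one_mul, ← hn, ← Set.ncard_coe_finset] at *
      simp only [Finset.coe_filter, Finset.mem_univ, true_and] at *
      exact_mod_cast this
    calc (B1.card : ℝ) ≤ ∑ p : Fin M × Fin M, ((Finset.univ.filter
        fun x : Fin M → V => p.1 ≠ p.2 ∧ x p.1 = x p.2).card : ℝ) := by
          exact_mod_cast Finset.card_biUnion_le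
      _ ≤ _ := Finset.sum_le_card_nsmul _ _ _ this
      _ = _ := by simp [sq, mul_assoc]
  have h2 : (B2.card : ℝ) ≤ M ^ 3 * (b * n ^ M / n) := by
    have : ∀ p ∈ (Finset.univ : Finset (Fin M × Fin M × Fin M)), ((Finset.univ.filter
        fun x : Fin M → V => (p.1 ≠ p.2.1 ∧ p.2.2 ≠ p.2.1) ∧
          B (x p.1) (x p.2.1) (x p.2.2)).card : ℝ) ≤ b * n ^ M / n := by
      intro p _
      rw [le_div_iff₀ hn0', mul_comm]
      have := card_sample_le (fun x : Fin M → V => (p.1 ≠ p.2.1 ∧ p.2.2 ≠ p.2.1) ∧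
          B (x p.1) (x p.2.1) (x p.2.2)) p.2.1 b (by
        intro x
        by_cases hp : p.1 ≠ p.2.1 ∧ p.2.2 ≠ p.2.1
        · simpa [hp, Function.update_of_ne] using hB (x p.1) (x p.2.2)
        · simp [hp])
      rw [← hn, ← Set.ncard_coe_finset] at *
      simp only [Finset.coe_filter, Finset.mem_univ, true_and] at *
      exact_mod_cast this
    calc (B2.card : ℝ) ≤ ∑ p : Fin M × Fin M × Fin M, ((Finset.univ.filter
        fun x : Fin M → V => (p.1 ≠ p.2.1 ∧ p.2.2 ≠ p.2.1) ∧
          B (x p.1) (x p.2.1) (x p.2.2)).card : ℝ) := by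
          exact_mod_cast Finset.card_biUnion_le
      _ ≤ _ := Finset.sum_le_card_nsmul _ _ _ this
      _ = _ := by
          simp only [Finset.card_univ, Fintype.card_prod, Fintype.card_fin, nsmul_eq_mul]
          push_cast
          ring
  have h3 : (B3.card : ℝ) ≤ M * (n * (n * (1 - η * q)) ^ (M - 1) / (1 - η) ^ r) := by
    have : ∀ i ∈ (Finset.univ : Finset (Fin M)), ((Finset.univ.filter
        fun x : Fin M → V => {j | D (x i) (x j)}.ncard < r).card : ℝ) ≤
        n * (n * (1 - η * q)) ^ (M - 1) / (1 - η) ^ r := by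
      intro i _
      rw [le_div_iff₀ (pow_pos hη' r), ← nsmul_eq_mul]
      refine le_trans ?_ (sum_pow_ncard_le D hη hη1 hD i)
      refine (Finset.card_nsmul_le_sum _ _ _ fun x hx => ?_).trans
        (Finset.sum_le_sum_of_subset_of_nonneg (Finset.subset_univ _)
          fun x _ _ => pow_nonneg hη'.le _)
      exact pow_le_pow_of_le_one hη'.le (by linarith) (Finset.mem_filter.1 hx).2.le
    calc (B3.card : ℝ) ≤ ∑ i : Fin M, ((Finset.univ.filter
        fun x : Fin M → V => {j | D (x i) (x j)}.ncard < r).card : ℝ) := by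
          exact_mod_cast Finset.card_biUnion_le
      _ ≤ _ := Finset.sum_le_card_nsmul _ _ _ this
      _ = _ := by simp
  have hM : 0 < M ∨ M = 0 := by omega
  rcases hM with hM | rfl
  swap
  · exact ⟨Fin.elim0, fun i => i.elim0, fun i => i.elim0, fun i => i.elim0⟩
  have hnM : (n : ℝ) ^ M = n * n ^ (M - 1) := by
    rw [← pow_succ', Nat.sub_add_cancel hM]
  have hcard : ((B1 ∪ B2 ∪ B3).card : ℝ) < (Finset.univ : Finset (Fin M → V)).card := by
    have h4 : ((B1 ∪ B2 ∪ B3).card : ℝ) ≤ B1.card + B2.card + B3.card := by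
      exact_mod_cast (Finset.card_union_le _ _).trans
        (Nat.add_le_add_right (Finset.card_union_le _ _) _)
    have h5 : ((Finset.univ : Finset (Fin M → V)).card : ℝ) = n ^ M := by simp [hn]
    rw [h5]
    calc ((B1 ∪ B2 ∪ B3).card : ℝ)
        ≤ M ^ 2 * (n ^ M / n) + M ^ 3 * (b * n ^ M / n) +
          M * (n * (n * (1 - η * q)) ^ (M - 1) / (1 - η) ^ r) := by linarith
      _ = (n : ℝ) ^ M * ((M : ℝ) ^ 2 / n + M ^ 3 * b / n +
          M * (1 - η * q) ^ (M - 1) / (1 - η) ^ r) := by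
          rw [mul_pow, hnM]; ring
      _ < n ^ M * 1 := mul_lt_mul_of_pos_left hlt (by positivity)
      _ = _ := mul_one _
  obtain ⟨x, -, hx⟩ := Finset.exists_mem_notMem_of_card_lt_card (by exact_mod_cast hcard)
  simp only [Finset.mem_union, not_or] at hx
  refine ⟨x, fun i j hij => ?_, fun i j k hij hik hjk hb => ?_, fun i => ?_⟩
  · by_contra hne
    exact hx.1.1 (Finset.mem_biUnion.2 ⟨(i, j), Finset.mem_univ _, by simp [hne, hij]⟩)
  · exact hx.1.2 (Finset.mem_biUnion.2 ⟨(i, j, k), Finset.mem_univ _, by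
      simp [hij, hjk.symm, hb]⟩)
  · by_contra hlt'
    exact hx.2 (Finset.mem_biUnion.2 ⟨i, Finset.mem_univ _, by simpa using hlt'⟩)

end Sampling

/-- For an edge density `(1 + κ) / (ℓ + 1)`, the probability that a sample of `(ℓ + 1) r`
vertices contains a vertex of out-degree less than `r` tends to zero as `r` grows. -/
lemma exists_sample_size (ℓ : ℕ) {κ : ℝ} (hκ : 0 < κ) (hκ1 : κ ≤ 1) :
    ∃ η : ℝ, 0 < η ∧ η < 1 ∧ ∃ r : ℕ, 0 < r ∧
      (((ℓ + 1) * r : ℕ) : ℝ) * (1 - η * ((1 + κ) / (ℓ + 1))) ^ ((ℓ + 1) * r - 1) / (1 - η) ^ r <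
        1 / 2 := by
  have hl : (0 : ℝ) < ℓ + 1 := by positivity
  set η := κ / (2 * (1 + κ)) with hη
  have hη0 : 0 < η := by positivity
  have hη1 : η < 1 := by rw [hη, div_lt_one (by positivity)]; linarith
  set p := 1 - η * ((1 + κ) / (ℓ + 1)) with hp
  have hp' : p = 1 - κ / 2 / (ℓ + 1) := by rw [hp, hη]; field_simp
  have hp0 : 0 < p := by
    have h1 : κ / 2 / (ℓ + 1) ≤ κ / 2 :=
      div_le_self (by positivity) (by linarith [Nat.cast_nonneg (α := ℝ) ℓ])
    rw [hp']
    linarith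
  have hη' : 0 < 1 - η := by linarith
  set ρ := p ^ (ℓ + 1) / (1 - η) with hρ
  have hρ0 : 0 ≤ ρ := by positivity
  have hρ1 : ρ < 1 := by
    rw [hρ, div_lt_one hη']
    have h1 : p ≤ Real.exp (-(κ / 2 / (ℓ + 1))) := by
      have := Real.add_one_le_exp (-(κ / 2 / ((ℓ : ℝ) + 1)))
      rw [hp']
      linarith
    have h2 : p ^ (ℓ + 1) ≤ Real.exp (-(κ / 2)) := by
      refine (pow_le_pow_left₀ hp0.le h1 _).trans_eq ?_
      rw [← Real.exp_nat_mul]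
      congr 1
      push_cast
      field_simp
    refine h2.trans_lt ?_
    have h3 : 1 + κ / 2 < Real.exp (κ / 2) := by
      have := Real.add_one_lt_exp (x := κ / 2) (by positivity)
      linarith
    have h4 : 1 - η = (2 + κ) / (2 * (1 + κ)) := by rw [hη]; field_simp; ring
    rw [Real.exp_neg, h4, inv_lt_comm₀ (Real.exp_pos _) (by positivity), inv_div]
    refine lt_of_le_of_lt ?_ h3
    rw [div_le_iff₀ (by positivity)]
    nlinarith
  refine ⟨η, hη0, hη1, ?_⟩
  have hlim := (tendsto_self_mul_const_pow_of_lt_one hρ0 hρ1).const_mul (((ℓ : ℝ) + 1) / p)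
  rw [mul_zero] at hlim
  obtain ⟨r, hr, hr0⟩ := ((hlim.eventually_lt_const (by norm_num : (0 : ℝ) < 1 / 2)).and
    (eventually_gt_atTop 0)).exists
  refine ⟨r, hr0, lt_of_eq_of_lt ?_ hr⟩
  have hM : p ^ ((ℓ + 1) * r) = p * p ^ ((ℓ + 1) * r - 1) := by
    rw [← pow_succ', Nat.sub_add_cancel (Nat.mul_pos (Nat.succ_pos ℓ) hr0)]
  rw [← hp, hρ, div_pow, ← pow_mul, hM]
  push_cast
  field_simp

/-- In a large tournament whose edges have two colours, some vertex robustly reaches all but a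
fraction `1 / (ℓ + 1) + ε` of the vertices, if the Caccetta-Häggkvist conjecture holds. -/
lemma CaccettaHaggkvist.exists_robust (hCH : CaccettaHaggkvist) {ℓ : ℕ} {ε : ℝ}
    (hε : 0 < ε) (hε1 : ε ≤ 1 / (ℓ + 1)) : ∃ δ : ℝ, 0 < δ ∧ ∃ n₀ : ℕ, ∀ n ≥ n₀,
      ∀ T : Digraph (Fin n), IsTournament T → ∀ (c : Fin n → Fin n → Fin 2) (s : ℕ),
        (s : ℝ) ≤ δ * n → ∃ v, ({u | NotRobust T c s ℓ v u}.ncard : ℝ) < (1 / (ℓ + 1) + ε) * n := by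
  have hl : (0 : ℝ) < ℓ + 1 := by positivity
  obtain ⟨η, hη0, hη1, r, hr, hlt⟩ := exists_sample_size ℓ (κ := ε * (ℓ + 1)) (by positivity)
    (by rwa [le_div_iff₀ hl] at hε1)
  have hq : (1 + ε * (ℓ + 1)) / ((ℓ : ℝ) + 1) = 1 / (ℓ + 1) + ε := by field_simp
  rw [hq] at hlt
  set M := (ℓ + 1) * r with hM
  have hM0 : (0 : ℝ) < M := by exact_mod_cast (by positivity : 0 < M)
  refine ⟨1 / (8 * (ℓ + 1) * M ^ 3), by positivity, 4 * M ^ 2 + 1, fun n hn T hT c s hs => ?_⟩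
  by_contra! hcon
  have hn0 : (0 : ℝ) < n := by exact_mod_cast (by omega : 0 < n)
  have : Nonempty (Fin n) := ⟨⟨0, by omega⟩⟩
  obtain ⟨x, hx, hdef, hdeg⟩ := exists_sample (M := M) (IsDefect T c s ℓ) (NotRobust T c s ℓ)
    (r := r) hη0 hη1 (fun v u => ncard_isDefect_le T c s ℓ v u)
    (fun v => by rw [Fintype.card_fin]; exact hcon v) (by
      rw [Fintype.card_fin]
      have h1 : (M : ℝ) ^ 2 / n < 1 / 4 := by
        rw [div_lt_iff₀ hn0]
        have : (4 * M ^ 2 + 1 : ℝ) ≤ n := by exact_mod_cast hn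
        linarith
      have h2 : (M : ℝ) ^ 3 * ((2 * ℓ * s : ℕ) : ℝ) / n ≤ 1 / 4 := by
        rw [div_le_iff₀ hn0]
        push_cast
        calc (M : ℝ) ^ 3 * (2 * (ℓ : ℝ) * (s : ℝ))
            ≤ M ^ 3 * (2 * ((ℓ : ℝ) + 1) * (1 / (8 * (ℓ + 1) * M ^ 3) * n)) := by
              gcongr
              linarith
          _ = 1 / 4 * (n : ℝ) := by field_simp; norm_num
      linarith)
  obtain ⟨i, hi⟩ := hCH.exists_outdegree_lt hT c s ℓ hr x hx hdef
  exact absurd (hdeg i) (not_le.2 hi)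

/-! ### Trees from robust walks -/

section RobustTree

variable {V : Type*} {k : ℕ} {T : Digraph V} {c : V → V → Fin k} {v : V} {s : ℕ}

/-- The tree `t'` is obtained from `t` by adding at most `i` new vertices, which avoid `X` and have
depth at most `i`. -/
structure MonoTree.Extends (t t' : MonoTree T c v) (X : Finset V) (i : ℕ) : Prop where
  subset : t.verts ⊆ t'.verts
  avoids : ∀ x ∈ t'.verts, x ∈ X → x ∈ t.verts
  card_le : t'.verts.card ≤ t.verts.card + i
  same : ∀ x ∈ t.verts, t'.dep x = t.dep x ∧ t'.par x = t.par x
  dep_le : ∀ x ∈ t'.verts, x ∈ t.verts ∨ t'.dep x ≤ i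

lemma MonoTree.Extends.exists_addLeaf [DecidableEq V] {t t₁ : MonoTree T c v} {X : Finset V} {i : ℕ}
    {u w : V} (h : t.Extends t₁ (insert u X) i) (hut : u ∉ t.verts) (huX : u ∉ X)
    (hw : w ∈ t₁.verts) (hdw : t₁.dep w ≤ i) (hadj : T.Adj w u)
    (hcw : w ≠ v → c (t₁.par w) w = c w u) :
    ∃ t', t.Extends t' X (i + 1) ∧ u ∈ t'.verts ∧ t'.dep u ≤ i + 1 ∧ t'.par u = w := by
  have hu1 : u ∉ t₁.verts := fun hu => hut (h.avoids u hu (Finset.mem_insert_self _ _))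
  obtain ⟨t', g1, g2, g3, g4⟩ := t₁.exists_addLeaf hu1 hw hadj hcw
  have g1' : t'.verts = insert u t₁.verts := by
    rw [← Finset.coe_inj, g1, Finset.coe_insert]
  refine ⟨t', ⟨?_, ?_, ?_, ?_, ?_⟩, ?_, by omega, g4⟩
  · rw [g1']; exact h.subset.trans (Finset.subset_insert _ _)
  · intro x hx hxX
    rw [g1'] at hx
    rcases Finset.mem_insert.1 hx with rfl | hx
    · exact absurd hxX huX
    · exact h.avoids x hx (Finset.mem_insert_of_mem hxX)
  · have := h.card_le
    rw [g1', Finset.card_insert_of_notMem hu1]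
    omega
  · intro x hx
    rw [(g2 x (h.subset hx)).1, (g2 x (h.subset hx)).2]
    exact h.same x hx
  · intro x hx
    rw [g1'] at hx
    rcases Finset.mem_insert.1 hx with rfl | hx
    · exact Or.inr (by omega)
    · rw [(g2 x hx).1]
      rcases h.dep_le x hx with h | h
      · exact Or.inl h
      · exact Or.inr (by omega)
  · rw [g1']; exact Finset.mem_insert_self _ _

/-- A robust walk from the root can be realised by a path that avoids any given small set `X` of
vertices, and so it can be added to a small tree. -/
lemma MonoTree.exists_addRobust (hT : ∀ x, ¬ T.Adj x x) {a : Fin k} (t : MonoTree T c v) (j : ℕ)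
    (X : Finset V) (u : V) (htX : t.verts ⊆ X) (huX : u ∉ X) (hs : X.card + j ≤ s)
    (hu : RobustWalk T c s a j v u) :
    ∃ t', t.Extends t' X j ∧ u ∈ t'.verts ∧ t'.dep u ≤ j ∧ c (t'.par u) u = a := by
  classical
  induction j generalizing X u with
  | zero => exact hu.elim
  | succ j ih =>
    rcases hu with ⟨hadj, hc⟩ | hu
    · obtain ⟨t', h1, h2, h3, h4⟩ := MonoTree.Extends.exists_addLeaf (t := t) (t₁ := t) (X := X)
        (i := j) (u := u) (w := v)
        ⟨subset_rfl, fun x hx _ => hx, Nat.le_add_right _ _, fun x _ => ⟨rfl, rfl⟩,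
          fun x hx => Or.inl hx⟩ (fun h => huX (htX h)) huX t.root_mem
        (by rw [t.dep_root]; exact Nat.zero_le _) hadj (fun h => absurd rfl h)
      exact ⟨t', h1, h2, h3, by rw [h4, hc]⟩
    · obtain ⟨w, ⟨hw, hadj, hc⟩, hwX⟩ :
          ∃ w ∈ {w | RobustWalk T c s a j v w ∧ T.Adj w u ∧ c w u = a},
          w ∉ (X : Set V) := by
        by_contra! h
        have := Set.ncard_le_ncard (ht := X.finite_toSet) h
        rw [Set.ncard_coe_finset] at this
        omega
      have hwX : w ∉ X := hwX
      have hwu : w ≠ u := by rintro rfl; exact hT _ hadj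
      obtain ⟨t₁, h1, h2, h3, h4⟩ := ih (insert u X) w (htX.trans (Finset.subset_insert _ _))
        (by simp [hwu, hwX]) (by rw [Finset.card_insert_of_notMem huX]; omega) hw
      obtain ⟨t', g1, g2, g3, g4⟩ := h1.exists_addLeaf (fun h => huX (htX h)) huX h2 h3 hadj
        (fun _ => h4.trans hc.symm)
      exact ⟨t', g1, g2, g3, by rw [g4, hc]⟩

/-- The vertices of a tree, and those that can be attached to it as leaves. -/
def MonoTree.attached (t : MonoTree T c v) : Set V :=
  {u | u ∈ t.verts ∨ ∃ w ∈ t.verts, T.Adj w u ∧ (w ≠ v → c (t.par w) w = c w u)}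

lemma MonoTree.Extends.attached_subset {t t' : MonoTree T c v} {X : Finset V} {i : ℕ}
    (h : t.Extends t' X i) : t.attached ⊆ t'.attached := by
  rintro u (hu | ⟨w, hw, hadj, hc⟩)
  · exact Or.inl (h.subset hu)
  · exact Or.inr ⟨w, h.subset hw, hadj, by rwa [(h.same w hw).2]⟩

/-- The vertices that are robustly reached from the root, but cannot be attached to the tree. -/
def MonoTree.missing (t : MonoTree T c v) (s ℓ : ℕ) : Set V :=
  {u | ∃ a, RobustWalk T c s a ℓ v u} \ t.attached

/-- Double counting: some robust path can be added to the tree so that many missing vertices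
become attached to its last vertex. -/
lemma MonoTree.exists_greedy_step [Fintype V] (hT : ∀ x, ¬ T.Adj x x) (t : MonoTree T c v) (h : ℕ)
    (hd : ∀ x ∈ t.verts, t.dep x ≤ h) (hs : t.verts.card + h ≤ s) :
    ∃ t' : MonoTree T c v, (∀ x ∈ t'.verts, t'.dep x ≤ h) ∧ t'.verts.card ≤ t.verts.card + h ∧
      (t.missing s (h + 1)).ncard * (s - t.verts.card) +
        Fintype.card V * k * (t'.missing s (h + 1)).ncard ≤
        Fintype.card V * k * (t.missing s (h + 1)).ncard := by
  classical
  set Y := t.missing s (h + 1) with hY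
  let C : V × Fin k → Set V := fun p =>
    {u | u ∈ Y ∧ p.1 ∉ t.verts ∧ RobustWalk T c s p.2 h v p.1 ∧ T.Adj p.1 u ∧ c p.1 u = p.2}
  have hcount : Y.ncard * (s - t.verts.card) ≤ ∑ p : V × Fin k, (C p).ncard := by
    have h1 : ∀ u ∈ Y,
        s - t.verts.card ≤ (Finset.univ.filter fun p : V × Fin k => u ∈ C p).card := by
      rintro u hu
      obtain ⟨⟨a, ha⟩, hna⟩ := id hu
      rcases ha with ⟨hadj, hc⟩ | ha
      · exact absurd (Or.inr ⟨v, t.root_mem, hadj, fun h => absurd rfl h⟩) hna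
      · have h2 :
            ({w | RobustWalk T c s a h v w ∧ T.Adj w u ∧ c w u = a} \ (t.verts : Set V)).ncard ≤
            (Finset.univ.filter fun p : V × Fin k => u ∈ C p).card := by
          rw [← Set.ncard_coe_finset]
          refine Set.ncard_le_ncard_of_injOn (fun w => (w, a)) ?_
            (fun x _ y _ hxy => congrArg Prod.fst hxy)
          rintro w ⟨hw, hwt⟩
          exact Finset.mem_coe.2 (Finset.mem_filter.2 ⟨Finset.mem_univ _, hu, hwt, hw⟩)
        refine le_trans ?_ h2
        have := Set.le_ncard_sdiff (t.verts : Set V)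
          {w | RobustWalk T c s a h v w ∧ T.Adj w u ∧ c w u = a}
        rw [Set.ncard_coe_finset] at this
        omega
    have h3 : Y.ncard = (Finset.univ.filter fun u => u ∈ Y).card := by
      rw [← Set.ncard_coe_finset]; simp
    have h4 : ∀ p, (C p).ncard =
        ((Finset.univ.filter fun u => u ∈ Y).filter fun u => u ∈ C p).card := by
      intro p
      rw [← Set.ncard_coe_finset]
      congr 1
      ext u
      simp only [C, Finset.coe_filter, Finset.mem_filter, Finset.mem_univ, true_and,
        Set.mem_ofPred_eq]
      tauto
    rw [h3, Finset.sum_congr rfl fun p _ => h4 p]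
    calc (Finset.univ.filter fun u => u ∈ Y).card * (s - t.verts.card)
        ≤ ∑ u ∈ Finset.univ.filter fun u => u ∈ Y,
            (Finset.univ.filter fun p : V × Fin k => u ∈ C p).card := by
          rw [← smul_eq_mul]
          exact Finset.card_nsmul_le_sum _ _ _ fun u hu => h1 u (Finset.mem_filter.1 hu).2
      _ = _ := Finset.sum_card_bipartiteAbove_eq_sum_card_bipartiteBelow fun u p => u ∈ C p
  by_cases hzero : Y.ncard * (s - t.verts.card) = 0
  · exact ⟨t, hd, Nat.le_add_right _ _, by rw [hzero, zero_add]⟩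
  obtain ⟨p, hp⟩ : ∃ p : V × Fin k,
      Y.ncard * (s - t.verts.card) ≤ Fintype.card V * k * (C p).ncard := by
    by_contra! hcon
    have hne : (Finset.univ : Finset (V × Fin k)).Nonempty := by
      rw [Finset.nonempty_iff_ne_empty]
      intro he
      rw [he, Finset.sum_empty] at hcount
      omega
    have h1 := Finset.sum_lt_sum_of_nonempty hne fun p _ => hcon p
    rw [← Finset.mul_sum] at h1
    simp only [Finset.sum_const, Finset.card_univ, Fintype.card_prod, Fintype.card_fin,
      smul_eq_mul] at h1
    have := Nat.mul_le_mul_left (Fintype.card V * k) hcount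
    omega
  have hCne : (C p).Nonempty := by
    rw [Set.nonempty_iff_ne_empty]
    intro he
    rw [he, Set.ncard_empty, mul_zero] at hp
    omega
  obtain ⟨-, -, hpt, hprob, -⟩ := hCne
  obtain ⟨t', h1, h2, h3, h4⟩ := t.exists_addRobust hT h t.verts p.1 subset_rfl hpt hs hprob
  have hCt : C p ⊆ t'.attached := fun u hu =>
    Or.inr ⟨p.1, h2, hu.2.2.2.1, fun _ => h4.trans hu.2.2.2.2.symm⟩
  have hsub : t'.missing s (h + 1) ∪ C p ⊆ Y := by
    rintro u (hu | hu)
    · exact ⟨hu.1, fun hu' => hu.2 (h1.attached_subset hu')⟩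
    · exact hu.1
  have hdisj : Disjoint (t'.missing s (h + 1)) (C p) := by
    rw [Set.disjoint_left]
    exact fun u hu hu' => hu.2 (hCt hu')
  have hcard := Set.ncard_le_ncard hsub
  rw [Set.ncard_union_eq hdisj] at hcard
  refine ⟨t', fun x hx => ?_, h1.card_le, ?_⟩
  · rcases h1.dep_le x hx with hx' | hx'
    · rw [(h1.same x hx').1]; exact hd x hx'
    · exact hx'
  · have := Nat.mul_le_mul_left (Fintype.card V * k) hcard
    rw [mul_add] at this
    omega

/-- Boundedly many greedy steps attach all but a small proportion of the vertices that are robustly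
reached. -/
lemma MonoTree.exists_missing_le [Fintype V] (hT : ∀ x, ¬ T.Adj x x) (v : V) (h K : ℕ)
    (hs : 2 * (1 + (K + 1) * h) ≤ s) {ε : ℝ} (hε : 0 < ε)
    (hK : 2 * k * Fintype.card V < K * ε * s) :
    ∃ t : MonoTree T c v, (∀ x ∈ t.verts, t.dep x ≤ h) ∧
      ((t.missing s (h + 1)).ncard : ℝ) ≤ ε * Fintype.card V := by
  set n := Fintype.card V with hn
  have hn0 : (0 : ℝ) < n := by exact_mod_cast Fintype.card_pos_iff.2 ⟨v⟩
  have key : ∀ i ≤ K, ∃ t : MonoTree T c v, (∀ x ∈ t.verts, t.dep x ≤ h) ∧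
      t.verts.card ≤ 1 + i * h ∧ (((t.missing s (h + 1)).ncard : ℝ) ≤ ε * n ∨
        2 * k * ((t.missing s (h + 1)).ncard : ℝ) + i * ε * s ≤ 2 * k * n) := by
    intro i
    induction i with
    | zero =>
      intro _
      refine ⟨MonoTree.single T c v, fun x _ => Nat.zero_le h, by simp [MonoTree.single], Or.inr ?_⟩
      have : ((MonoTree.single T c v).missing s (h + 1)).ncard ≤ n := by
        rw [hn, ← Nat.card_eq_fintype_card, ← Set.ncard_univ]
        exact Set.ncard_le_ncard (Set.subset_univ _)
      have : (((MonoTree.single T c v).missing s (h + 1)).ncard : ℝ) ≤ n := by exact_mod_cast this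
      have := mul_le_mul_of_nonneg_left this (by positivity : (0 : ℝ) ≤ 2 * k)
      simpa using this
    | succ i ih =>
      intro hi
      obtain ⟨t, hd, hcard, hmiss⟩ := ih (by omega)
      have hih : 1 + i * h + h ≤ 1 + (K + 1) * h := by
        have := Nat.mul_le_mul_right h (show i + 1 ≤ K + 1 by omega)
        rw [add_mul, one_mul] at this
        omega
      obtain ⟨t', hd', hcard', hmiss'⟩ := t.exists_greedy_step (s := s) hT h hd (by omega)
      refine ⟨t', hd', by rw [add_mul, one_mul]; omega, ?_⟩
      have hle : (s : ℝ) / 2 ≤ ((s - t.verts.card : ℕ) : ℝ) := by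
        have : s ≤ 2 * (s - t.verts.card) := by omega
        have : (s : ℝ) ≤ 2 * ((s - t.verts.card : ℕ) : ℝ) := by exact_mod_cast this
        linarith
      have hm : ((t.missing s (h + 1)).ncard : ℝ) * ((s - t.verts.card : ℕ) : ℝ) +
          n * k * (t'.missing s (h + 1)).ncard ≤ n * k * (t.missing s (h + 1)).ncard := by
        exact_mod_cast hmiss'
      have hm2 : ((t.missing s (h + 1)).ncard : ℝ) * (s / 2) +
          n * k * (t'.missing s (h + 1)).ncard ≤ n * k * (t.missing s (h + 1)).ncard :=
        le_trans (by gcongr) hm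
      by_cases hsmall : ((t'.missing s (h + 1)).ncard : ℝ) ≤ ε * n
      · exact Or.inl hsmall
      right
      push Not at hsmall
      rcases Nat.eq_zero_or_pos k with rfl | hk
      · exfalso
        have : (t'.missing s (h + 1)) = ∅ := by
          rw [Set.eq_empty_iff_forall_notMem]
          rintro u ⟨⟨a, -⟩, -⟩
          exact a.elim0
        rw [this, Set.ncard_empty, Nat.cast_zero] at hsmall
        linarith [mul_pos hε hn0]
      have hk' : (0 : ℝ) < k := by exact_mod_cast hk
      have hs0 : (0 : ℝ) ≤ s := Nat.cast_nonneg s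
      have hmono : ((t'.missing s (h + 1)).ncard : ℝ) ≤ (t.missing s (h + 1)).ncard := by
        refine le_of_mul_le_mul_left ?_ (mul_pos hn0 hk')
        have : 0 ≤ ((t.missing s (h + 1)).ncard : ℝ) * (s / 2) := by positivity
        linarith
      have hbig : ε * n ≤ ((t.missing s (h + 1)).ncard : ℝ) := by linarith
      rcases hmiss with hmiss | hmiss
      · linarith
      · have h1 : ε * n * (s / 2) + n * k * (t'.missing s (h + 1)).ncard ≤
            n * k * (t.missing s (h + 1)).ncard :=
          le_trans (by gcongr) hm2
        have h2 : ε * (s / 2) + k * (t'.missing s (h + 1)).ncard ≤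
            k * ((t.missing s (h + 1)).ncard : ℝ) := by
          refine le_of_mul_le_mul_left ?_ hn0
          calc (n : ℝ) * (ε * (s / 2) + k * (t'.missing s (h + 1)).ncard)
              = ε * n * (s / 2) + n * k * (t'.missing s (h + 1)).ncard := by ring
            _ ≤ n * k * (t.missing s (h + 1)).ncard := h1
            _ = _ := by ring
        push_cast
        linarith
  obtain ⟨t, hd, -, hmiss⟩ := key K le_rfl
  refine ⟨t, hd, ?_⟩
  rcases hmiss with hmiss | hmiss
  · exact hmiss
  · exfalso
    have : (0 : ℝ) ≤ 2 * k * ((t.missing s (h + 1)).ncard : ℝ) := by positivity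
    linarith

/-- There is a path-monochromatic tree of depth at most `h + 1` that contains almost all vertices
that are robustly reached from its root. -/
lemma MonoTree.exists_of_robust [Fintype V] (hT : ∀ x, ¬ T.Adj x x) (v : V) (h K : ℕ)
    (hs : 2 * (1 + (K + 1) * h) ≤ s) {ε : ℝ} (hε : 0 < ε)
    (hK : 2 * k * Fintype.card V < K * ε * s) :
    ∃ t : MonoTree T c v, (∀ x ∈ t.verts, t.dep x ≤ h + 1) ∧
      (Fintype.card V : ℝ) ≤
        t.verts.card + ε * Fintype.card V + {u | NotRobust T c s (h + 1) v u}.ncard := by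
  classical
  obtain ⟨t, hd, hmiss⟩ := MonoTree.exists_missing_le (c := c) hT v h K hs hε hK
  obtain ⟨t', h1, h2, h3, h4⟩ := t.exists_addLeaves (L := h + 1)
    (fun x hx => (hd x hx).trans (Nat.le_succ h)) (Finset.univ.filter fun u => u ∈ t.attached) (by
      intro u hu
      rcases (Finset.mem_filter.1 hu).2 with hu | ⟨w, hw, hadj, hc⟩
      · exact Or.inl hu
      · exact Or.inr ⟨w, hw, hadj, Nat.lt_succ_of_le (hd w hw), hc⟩)
  refine ⟨t', h4, ?_⟩
  have hcover : (Set.univ : Set V) ⊆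
      (t'.verts : Set V) ∪ t.missing s (h + 1) ∪ {u | NotRobust T c s (h + 1) v u} := by
    intro u _
    by_cases hu : u ∈ t.attached
    · exact Or.inl (Or.inl (h2 (by simpa using hu)))
    · by_cases hr : ∃ a, RobustWalk T c s a (h + 1) v u
      · exact Or.inl (Or.inr ⟨hr, hu⟩)
      · push Not at hr
        exact Or.inr ⟨by rintro rfl; exact hu (Or.inl t.root_mem), hr⟩
  have hcard : Fintype.card V ≤ t'.verts.card + (t.missing s (h + 1)).ncard +
      {u | NotRobust T c s (h + 1) v u}.ncard := by
    rw [← Nat.card_eq_fintype_card, ← Set.ncard_univ, ← Set.ncard_coe_finset t'.verts]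
    exact (Set.ncard_le_ncard hcover).trans ((Set.ncard_union_le _ _).trans
      (Nat.add_le_add_right (Set.ncard_union_le _ _) _))
  have hcard' : (Fintype.card V : ℝ) ≤ t'.verts.card + (t.missing s (h + 1)).ncard +
      {u | NotRobust T c s (h + 1) v u}.ncard := by exact_mod_cast hcard
  linarith

end RobustTree

/-! ### Two colours under the Caccetta-Häggkvist conjecture -/

lemma CaccettaHaggkvist.eventually_lt_fDepth (hCH : CaccettaHaggkvist) {ℓ : ℕ} (hℓ : 1 ≤ ℓ) {ε : ℝ}
    (hε : 0 < ε) :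
    ∀ᶠ n : ℕ in atTop, (ℓ : ℝ) / (ℓ + 1) - ε < (fDepth 2 ℓ n : ℝ) / n := by
  obtain ⟨h, rfl⟩ : ∃ h, ℓ = h + 1 := ⟨ℓ - 1, by omega⟩
  set ε' := min (ε / 4) (1 / (((h + 1 : ℕ) : ℝ) + 1)) with hε'
  have hε0 : 0 < ε' := lt_min (by positivity) (by positivity)
  have hε4 : ε' ≤ ε / 4 := min_le_left _ _
  obtain ⟨δ, hδ, n₀, hrob⟩ := hCH.exists_robust (ℓ := h + 1) hε0 (min_le_right _ _)
  obtain ⟨K, hK⟩ := exists_nat_gt (8 / (ε' * δ))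
  filter_upwards [eventually_ge_atTop n₀,
    eventually_ge_atTop ⌈(2 * (1 + (K + 1) * h) + 1 : ℕ) / δ⌉₊,
    eventually_ge_atTop ⌈2 / δ⌉₊, eventually_gt_atTop 0] with n hn1 hn2 hn3 hn4
  have hn : (0 : ℝ) < n := by exact_mod_cast hn4
  set s := ⌊δ * n⌋₊ with hs
  have hs1 : (s : ℝ) ≤ δ * n := Nat.floor_le (by positivity)
  have hs2 : δ * n < s + 1 := Nat.lt_floor_add_one _
  have hs3 : 2 * (1 + (K + 1) * h) ≤ s := by
    have h1 : ((2 * (1 + (K + 1) * h) + 1 : ℕ) : ℝ) ≤ δ * n := by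
      have := (Nat.le_ceil _).trans (Nat.cast_le (α := ℝ).2 hn2)
      rwa [div_le_iff₀ hδ, mul_comm (n : ℝ)] at this
    exact Nat.le_floor (le_trans (by exact_mod_cast Nat.le_succ _) h1)
  have hs4 : δ * n / 2 ≤ s := by
    have := (Nat.le_ceil _).trans (Nat.cast_le (α := ℝ).2 hn3)
    rw [div_le_iff₀ hδ, mul_comm] at this
    linarith
  have hK' : 2 * (2 : ℕ) * (n : ℝ) < K * ε' * s := by
    rw [div_lt_iff₀ (by positivity)] at hK
    have h1 : (K : ℝ) * ε' * (δ * n / 2) ≤ K * ε' * s := by gcongr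
    have h2 := mul_lt_mul_of_pos_right hK hn
    push_cast
    linarith
  have hmain : ⌈((((h + 1 : ℕ) : ℝ) / (((h + 1 : ℕ) : ℝ) + 1)) - 2 * ε') * n⌉₊ ≤
      fDepth 2 (h + 1) n := by
    refine le_fDepth two_pos fun T hT c => ?_
    obtain ⟨v, hv⟩ := hrob n hn1 T hT c s hs1
    obtain ⟨t, hd, ht⟩ := MonoTree.exists_of_robust (c := c) (s := s) hT.loopless v h K hs3 hε0
      (by rw [Fintype.card_fin]; exact hK')
    refine ⟨v, t, hd, Nat.ceil_le.2 ?_⟩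
    rw [Fintype.card_fin] at ht
    have h1 : ((h + 1 : ℕ) : ℝ) / (((h + 1 : ℕ) : ℝ) + 1) = 1 - 1 / (((h + 1 : ℕ) : ℝ) + 1) := by
      field_simp
      ring
    rw [h1]
    linarith
  have hmain' := Nat.ceil_le.1 hmain
  rw [lt_div_iff₀ hn]
  refine lt_of_lt_of_le (mul_lt_mul_of_pos_right ?_ hn) hmain'
  linarith

theorem CaccettaHaggkvist.fDepthLimit (hCH : CaccettaHaggkvist) {ℓ : ℕ} (hℓ : 1 ≤ ℓ) :
    FDepthLimit 2 ℓ ((ℓ : ℝ) / ((ℓ : ℝ) + 1)) :=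
  tendsto_of_reachBound (L := ℓ) two_pos (fun _ _ h => h.fDepth_le)
    (fun _ hε => hCH.eventually_lt_fDepth hℓ hε) fun _ hε => exists_reachBound_cyclic hℓ hε

end PathMono

theorem theorem1 :
    (∃ x : ℝ, PathMono.FDepthLimit 2 2 x ∧ x ∈ Set.Icc (Real.sqrt 7 - 2) (2 / 3)) ∧
    (PathMono.CaccettaHaggkvist →
      ∀ ℓ : ℕ, 2 ≤ ℓ → PathMono.FDepthLimit 2 ℓ ((ℓ : ℝ) / ((ℓ : ℝ) + 1))) ∧
    (∀ k : ℕ, 3 ≤ k → PathMono.FLimit k (1 / 2) ∧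
      ∀ ℓ : ℕ, 2 ≤ ℓ → PathMono.FDepthLimit k ℓ (1 / 2)) := by
  refine ⟨PathMono.exists_fDepthLimit_two, fun hCH ℓ hℓ => hCH.fDepthLimit (one_le_two.trans hℓ),
    fun k hk => ⟨PathMono.fLimit_three hk, fun ℓ hℓ =>
      PathMono.fDepthLimit_three hk (one_le_two.trans hℓ)⟩⟩
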